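/- Fix integers $n,r\ge 0$, write $E=\{0,\dots,n\}$, and let $X$ be the $n$-dimensional permutohedral variety, with rational Chow ring $$\mathrm{CH}(X)=\mathbb{Q}[x_F : \emptyset\subsetneq F\subsetneq E]\,/\,(I_q+I_l),$$ where $I_q$ is generated by the products $x_Fx_G$ for $F,G$ incomparable under inclusion and $I_l$ by the linear forms $\sum_{F\ni a}x_F-\sum_{F\ni b}x_F$ for $a,b\in E$. Let $\int_X:\mathrm{CH}^n(X)\to\mathbb{Q}$ be the degree map, sending $x_{F_1}\cdots x_{F_n}$ to $1$ for every complete chain $F_1\subsetneq\dots\subsetneq F_n$ of nonempty proper subsets of $E$ (extended by $0$ to the other degrees). For $1\le i\le n$ let $$L_i=\sum_{\emptyset\subsetneq S\subsetneq E}c_{i,S}\,x_S,\qquad c_{i,S}=\begin{cases}\min(n+1-i,|S|) & n\notin S,\\ \min(n+1-i,|S|)-(n+1-i) & n\in S.\end{cases}$$ For a loopless matroid $M$ on $E$ of rank $r+1$ let $[X_M]\in \mathrm{CH}^{n-r}(X)$ be the unique class such that, for every chain $F_1\subsetneq\dots\subsetneq F_r$ of nonempty proper subsets of $E$, the number $\int_X[X_M]\,x_{F_1}\cdots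 x_{F_r}$ equals $1$ if all $F_i$ are flats of $M$ and $0$ otherwise. For nonnegative integers $a_1,\dots,a_n$ with $\sum_i a_i=r$, the matroidal mixed Eulerian number is $$A_M(a_1,\dots,a_n)=\int_X[X_M]\,L_1^{a_1}\cdots L_n^{a_n}.$$ Derksen's $\mathcal{G}$-invariant of $M$ is the formal $\mathbb{Z}$-linear combination of sequences $\mathcal{G}(M)=\sum_{\sigma\in\mathfrak{S}_{n+1}}[r_0(\sigma),\dots,r_n(\sigma)]$, the sum being over all permutations of $E$, where $r_j(\sigma)=\mathrm{rk}_M\{\sigma(0),\dots,\sigma(j)\}-\mathrm{rk}_M\{\sigma(0),\dots,\sigma(j-1)\}$. **Theorem.** Let $M_1,M_2$ be two loopless matroids of rank $r+1$ on $E$. Then $\mathcal{G}(M_1)=\mathcal{G}(M_2)$ if and only if $$A_{M_1}(a_1,\dots,a_n)=A_{M_2}(a_1,\dots,a_n)$$ for all nonnegative integers $a_1,\dots,a_n$ with $\sum_{i=1}^n a_i=r$. -/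

import Mathlib

noncomputable section

namespace Permutohedral

open MvPolynomial

/-- The nonempty proper subsets of `{0, …, n}`; they index the rays of the normal fan of the
`n`-dimensional permutohedron, i.e. the torus-invariant prime divisors of its toric variety. -/
abbrev ProperSubset (n : ℕ) : Type :=
  {S : Finset (Fin (n + 1)) // S.Nonempty ∧ S ≠ Finset.univ}

/-- The quadratic relations: `x_F * x_G` for `F`, `G` incomparable under inclusion. -/
def quadraticRelations (n : ℕ) : Set (MvPolynomial (ProperSubset n) ℚ) :=
  {p | ∃ F G : ProperSubset n, ¬ F.1 ⊆ G.1 ∧ ¬ G.1 ⊆ F.1 ∧ p = X F * X G}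

/-- The linear relations: `∑_{F ∋ a} x_F - ∑_{F ∋ b} x_F` for elements `a`, `b` of `{0, …, n}`. -/
def linearRelations (n : ℕ) : Set (MvPolynomial (ProperSubset n) ℚ) :=
  {p | ∃ a b : Fin (n + 1),
    p = (∑ F : ProperSubset n, if a ∈ F.1 then X F else 0) -
        (∑ F : ProperSubset n, if b ∈ F.1 then X F else 0)}

/-- The ideal of all relations among the torus-invariant prime divisors. -/
def relationIdeal (n : ℕ) : Ideal (MvPolynomial (ProperSubset n) ℚ) :=
  Ideal.span (linearRelations n) ⊔ Ideal.span (quadraticRelations n)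

/-- The rational Chow ring of the permutohedral variety of dimension `n`. -/
abbrev Chow (n : ℕ) : Type :=
  MvPolynomial (ProperSubset n) ℚ ⧸ relationIdeal n

/-- The class `x_F` of the torus-invariant prime divisor belonging to `F`. -/
def divisorClass {n : ℕ} (F : ProperSubset n) : Chow n :=
  Ideal.Quotient.mk (relationIdeal n) (X F)

/-- The coefficient of `x_S` in `L_i`. -/
def hypersimplexCoeff (n i : ℕ) (S : Finset (Fin (n + 1))) : ℚ :=
  if Fin.last n ∈ S then min ((n : ℚ) + 1 - i) (S.card : ℚ) - ((n : ℚ) + 1 - i)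
  else min ((n : ℚ) + 1 - i) (S.card : ℚ)

/-- The divisor class `L_i`, for `1 ≤ i ≤ n`: the pull-back of the hyperplane class under the
map to projective space given by the `i`-th hypersimplex. -/
def hypersimplexDivisor (n i : ℕ) : Chow n :=
  ∑ S : ProperSubset n, hypersimplexCoeff n i S.1 • divisorClass S

/-- A cone of the permutohedral fan: a set of nonempty proper subsets that is totally ordered
by inclusion. Its dimension is the number of its members. -/
def IsCone {n : ℕ} (c : Finset (ProperSubset n)) : Prop :=
  ∀ F ∈ c, ∀ G ∈ c, F.1 ⊆ G.1 ∨ G.1 ⊆ F.1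

/-- The class of the torus-invariant subvariety belonging to the cone `c`. -/
def coneClass {n : ℕ} (c : Finset (ProperSubset n)) : Chow n :=
  ∏ F ∈ c, divisorClass F

/-- `φ` is the degree map: a maximal cone (the class of a point) is sent to `1`, the cones of
smaller dimension to `0`. The classes of cones span the Chow ring, so this determines `φ`. -/
def IsDegreeMap {n : ℕ} (φ : Chow n →ₗ[ℚ] ℚ) : Prop :=
  ∀ c : Finset (ProperSubset n), IsCone c → φ (coneClass c) = if c.card = n then 1 else 0

open Classical in
/-- The degree map `∫` on the Chow ring of the permutohedral variety. -/
def degreeMap (n : ℕ) : Chow n →ₗ[ℚ] ℚ :=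
  if h : ∃ φ : Chow n →ₗ[ℚ] ℚ, IsDegreeMap φ then h.choose else 0

open Classical in
/-- `ξ` is the class `[X_M]` of a loopless matroid `M`: its pairing with the class of a cone is
`1` if the cone has dimension `rk M - 1` and consists of flats of `M`, and is `0` otherwise.
(The pairings with cones of dimension other than `rk M - 1` vanish because `[X_M]` lies in
degree `n - (rk M - 1)`. As the classes of cones span the Chow ring and the Poincaré pairing is
perfect, this determines `ξ`.) -/
def IsMatroidClass {n : ℕ} (M : Matroid (Fin (n + 1))) (ξ : Chow n) : Prop :=
  ∀ c : Finset (ProperSubset n), IsCone c →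
    degreeMap n (ξ * coneClass c) =
      if ((c.card : ℕ∞) + 1 = M.eRank ∧ ∀ F ∈ c, M.IsFlat (F.1 : Set (Fin (n + 1)))) then 1 else 0

open Classical in
/-- The class `[X_M]` of a loopless matroid `M` on `{0, …, n}`. -/
def matroidClass {n : ℕ} (M : Matroid (Fin (n + 1))) : Chow n :=
  if h : ∃ ξ : Chow n, IsMatroidClass M ξ then h.choose else 0

/-- The matroidal mixed Eulerian number `A_M(a_1, …, a_n) = ∫ [X_M] L_1^{a_1} ⋯ L_n^{a_n}`;
here `a_i` is `a (i - 1)`. -/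
def mixedEulerian {n : ℕ} (M : Matroid (Fin (n + 1))) (a : Fin n → ℕ) : ℚ :=
  degreeMap n (matroidClass M * ∏ i : Fin n, hypersimplexDivisor n ((i : ℕ) + 1) ^ a i)

/-- The rank of `{σ 0, …, σ (k - 1)}` in `M`. -/
def prefixRank {n : ℕ} (M : Matroid (Fin (n + 1))) (σ : Equiv.Perm (Fin (n + 1))) (k : ℕ) : ℕ :=
  (M.eRk (σ '' {i : Fin (n + 1) | (i : ℕ) < k})).toNat

/-- The rank sequence `(r_0, …, r_n)` of a permutation `σ`:
`r_j = rk {σ 0, …, σ j} - rk {σ 0, …, σ (j - 1)}`. -/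
def rankSequence {n : ℕ} (M : Matroid (Fin (n + 1))) (σ : Equiv.Perm (Fin (n + 1))) :
    Fin (n + 1) → ℕ :=
  fun j => prefixRank M σ ((j : ℕ) + 1) - prefixRank M σ (j : ℕ)

/-- Derksen's `𝒢`-invariant: the formal `ℤ`-linear combination of sequences
`∑_σ [r(σ)]`, over all permutations `σ` of the ground set. -/
def gInvariant {n : ℕ} (M : Matroid (Fin (n + 1))) : (Fin (n + 1) → ℕ) →₀ ℤ :=
  ∑ σ : Equiv.Perm (Fin (n + 1)), Finsupp.single (rankSequence M σ) 1

end Permutohedral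

end

/-!
Both invariants are determined by, and determine, the numbers `N_M(K)` of complete flags of flats
of `M` whose members have the cardinalities in a given set `K ⊆ {1, …, n}` with `|K| = r`
(`flagCount`).

*The mixed Eulerian numbers.* Let `Y_k` be the sum of the `x_F` with `|F| = k` (`sizeClass`) and put
`ℓ_m = L_{n + 1 - m}` (`hypersimplexClass`). Modulo the linear relations, `ℓ_m` is represented by the
function `S ↦ min m |S| - |S ∩ A|` for every `A` with `|A| = m`. Hence `Y` is the negative of the
second difference of `ℓ`, which vanishes at `0` and at `n + 1`, and `ℓ_m Y_m = 0`. A maximum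
principle for second differences (`eq_zero_of_affine`) shows that these relations alone allow
every monomial of degree `r` in the `ℓ_m` to be written as a combination of the squarefree monomials
of degree `r` in the `Y_k`, and conversely (`IsHypersimplexPair.forall_monomial_iff`). Finally,
`∫ [X_M] ∏_{k ∈ K} Y_k = N_M(K)` by expanding the product into classes of cones.

*The `𝒢`-invariant.* The closures of the prefixes of a permutation `σ` form a complete flag of
flats. A given flag arises from `σ` exactly if the word of the levels of `σ 0, …, σ n` in the flag
has restricted growth, and the rank sequence of `σ` is then the record sequence of this word
(`IsRankFunction.existsUnique_flag`, `IsRankFlag.rank_prefixSet_eq`). So the flag contributes to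
`𝒢(M)` a sum that depends only on the cardinalities `K` of its members; these sums are linearly
independent, being triangular with respect to the pointwise order of the increasing words of the
sets `K` (`recordSum_independent`).

*The degree map and the class of a matroid* have to be shown to exist. The degree map is given by the
localization formula at the torus-fixed points, that is, as a sum over all permutations; it
descends to the Chow ring because the sum vanishes on monomials of degree less than `n`
(`localization_eq_zero_of_lt`). The class `[X_M]` is a product of divisors: the Higgs lifts of `M`,
with rank functions `S ↦ min |S| (rk S + i)`, lead from `M` to the free matroid, and each is an
elementary quotient of the next. Multiplication with the divisor of the piecewise linear function
given by the difference of the rank functions turns the functional that counts complete flags of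
a matroid into the one of its elementary quotient (`map_quotientDivisor_mul_coneClass`).
-/

noncomputable section

namespace Permutohedral

open MvPolynomial

variable {n : ℕ}

/-! ### Chains of sets and permutations -/

/-- The set `{σ 0, …, σ (k - 1)}`. -/
def prefixSet (σ : Equiv.Perm (Fin (n + 1))) (k : ℕ) : Finset (Fin (n + 1)) :=
  Finset.univ.filter fun a => (σ.symm a : ℕ) < k

@[simp]
lemma mem_prefixSet {σ : Equiv.Perm (Fin (n + 1))} {k : ℕ} {a : Fin (n + 1)} :
    a ∈ prefixSet σ k ↔ (σ.symm a : ℕ) < k := by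
  simp [prefixSet]

lemma prefixSet_mono (σ : Equiv.Perm (Fin (n + 1))) : Monotone (prefixSet σ) := by
  intro k l hkl a
  simp only [mem_prefixSet]
  omega

lemma prefixSet_eq_map (σ : Equiv.Perm (Fin (n + 1))) (k : ℕ) : prefixSet σ k
    = (Finset.univ.filter fun i : Fin (n + 1) => (i : ℕ) < k).map σ.toEmbedding := by
  ext a
  simp

lemma card_prefixSet (σ : Equiv.Perm (Fin (n + 1))) {k : ℕ} (hk : k ≤ n + 1) :
    (prefixSet σ k).card = k := by
  rw [prefixSet_eq_map, Finset.card_map, Fin.card_filter_val_lt]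
  omega

/-- A set all of whose elements come before all the others is a prefix. -/
lemma eq_prefixSet_of_forall_lt {σ : Equiv.Perm (Fin (n + 1))} {F : Finset (Fin (n + 1))}
    (h : ∀ a ∈ F, ∀ b ∉ F, σ.symm a < σ.symm b) : F = prefixSet σ F.card := by
  have hc : (prefixSet σ F.card).card = F.card :=
    card_prefixSet σ (by simpa using F.card_le_univ)
  by_cases hF : F ⊆ prefixSet σ F.card
  · exact Finset.eq_of_subset_of_card_le hF hc.le
  · obtain ⟨a, haF, ha⟩ := Finset.not_subset.1 hF
    symm
    refine Finset.eq_of_subset_of_card_le (fun b hb => ?_) hc.ge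
    by_contra hbF
    have := h a haF b hbF
    simp only [mem_prefixSet] at ha hb
    rw [Fin.lt_def] at this
    omega

lemma ProperSubset.card_pos (F : ProperSubset n) : 0 < F.1.card :=
  Finset.card_pos.2 F.2.1

lemma ProperSubset.card_le (F : ProperSubset n) : F.1.card ≤ n := by
  have := (Finset.card_lt_iff_ne_univ F.1).2 F.2.2
  simpa [Nat.lt_succ_iff] using this

lemma IsCone.subset {c d : Finset (ProperSubset n)} (hd : IsCone d) (h : c ⊆ d) : IsCone c :=
  fun F hF G hG => hd F (h hF) G (h hG)

lemma IsCone.insert {c : Finset (ProperSubset n)} (hc : IsCone c) {F : ProperSubset n}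
    (hF : ∀ G ∈ c, F.1 ⊆ G.1 ∨ G.1 ⊆ F.1) : IsCone (insert F c) := by
  intro A hA B hB
  rcases Finset.mem_insert.1 hA with hA' | hA' <;> rcases Finset.mem_insert.1 hB with hB' | hB'
  · exact Or.inl (hA'.trans hB'.symm ▸ subset_rfl)
  · exact hA' ▸ hF B hB'
  · exact hB' ▸ (hF A hA').symm
  · exact hc A hA' B hB'

lemma IsCone.card_injOn {c : Finset (ProperSubset n)} (hc : IsCone c) :
    Set.InjOn (fun F : ProperSubset n => F.1.card) c := by
  intro F hF G hG h
  rcases hc F hF G hG with h' | h'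
  · exact Subtype.ext (Finset.eq_of_subset_of_card_le h' (le_of_eq h.symm))
  · exact Subtype.ext (Finset.eq_of_subset_of_card_le h' (le_of_eq h)).symm

/-- The number of members of the chain `c` that do not contain `a`. -/
def coneLevel (c : Finset (ProperSubset n)) (a : Fin (n + 1)) : ℕ :=
  (c.filter fun F => a ∉ F.1).card

lemma coneLevel_le (c : Finset (ProperSubset n)) (a : Fin (n + 1)) : coneLevel c a ≤ c.card :=
  Finset.card_filter_le _ _

lemma IsCone.coneLevel_lt {c : Finset (ProperSubset n)} (hc : IsCone c) {F : ProperSubset n}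
    (hF : F ∈ c) {a b : Fin (n + 1)} (ha : a ∈ F.1) (hb : b ∉ F.1) :
    coneLevel c a < coneLevel c b := by
  refine Finset.card_lt_card ((Finset.ssubset_iff_of_subset fun G hG => ?_).2 ⟨F, ?_, ?_⟩)
  · rw [Finset.mem_filter] at hG ⊢
    refine ⟨hG.1, fun hbG => ?_⟩
    rcases hc F hF G hG.1 with h | h
    · exact hG.2 (h ha)
    · exact hb (h hbG)
  · simp [hF, hb]
  · simp [ha]

/-- Every chain is part of the chain of prefixes of some permutation. -/
lemma IsCone.exists_perm {c : Finset (ProperSubset n)} (hc : IsCone c) :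
    ∃ σ : Equiv.Perm (Fin (n + 1)), ∀ F ∈ c, F.1 = prefixSet σ F.1.card := by
  refine ⟨Tuple.sort (coneLevel c), fun F hF => eq_prefixSet_of_forall_lt fun a ha b hb => ?_⟩
  by_contra hlt
  have := Tuple.monotone_sort (coneLevel c) (not_lt.1 hlt)
  simp only [Function.comp_apply, Equiv.apply_symm_apply] at this
  exact absurd (hc.coneLevel_lt hF ha hb) (not_lt.2 this)

/-- A chain that is not maximal does not separate all elements. -/
lemma IsCone.exists_not_separated {c : Finset (ProperSubset n)} (hc : IsCone c)
    (hcard : c.card < n) : ∃ a b : Fin (n + 1), a ≠ b ∧ ∀ F ∈ c, a ∈ F.1 ↔ b ∈ F.1 := by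
  obtain ⟨a, -, b, -, hab, h⟩ := Finset.exists_ne_map_eq_of_card_lt_of_maps_to
    (s := (Finset.univ : Finset (Fin (n + 1)))) (t := Finset.range (c.card + 1))
    (f := coneLevel c) (by simpa using hcard)
    (fun a _ => by simpa [Nat.lt_succ_iff] using coneLevel_le c a)
  refine ⟨a, b, hab, fun F hF => ⟨fun ha => ?_, fun hb => ?_⟩⟩
  · by_contra hb
    exact absurd h (hc.coneLevel_lt hF ha hb).ne
  · by_contra ha
    exact absurd h (hc.coneLevel_lt hF hb ha).ne'

/-- For every member `F` of a chain there are two elements that only `F` separates. -/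
lemma IsCone.exists_separated {c : Finset (ProperSubset n)} (hc : IsCone c)
    {F : ProperSubset n} (hF : F ∈ c) :
    ∃ a ∈ F.1, ∃ b ∉ F.1, ∀ G ∈ c, G ≠ F → (a ∈ G.1 ↔ b ∈ G.1) := by
  obtain ⟨a, ha, hamax⟩ := Finset.exists_max_image F.1 (coneLevel c) F.2.1
  have hne : (F.1ᶜ).Nonempty := by
    rw [Finset.nonempty_iff_ne_empty, Ne, Finset.compl_eq_empty_iff]
    exact F.2.2
  obtain ⟨b, hb, hbmin⟩ := Finset.exists_min_image F.1ᶜ (coneLevel c) hne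
  rw [Finset.mem_compl] at hb
  refine ⟨a, ha, b, hb, fun G hG hGF => ?_⟩
  rcases hc G hG F hF with h | h
  · obtain ⟨x, hxF, hxG⟩ := Finset.exists_of_ssubset
      (Finset.ssubset_iff_subset_ne.2 ⟨h, fun e => hGF (Subtype.ext e)⟩)
    have haG : a ∉ G.1 := fun haG =>
      absurd (hc.coneLevel_lt hG haG hxG) (not_lt.2 (hamax x hxF))
    exact iff_of_false haG fun hbG => hb (h hbG)
  · obtain ⟨x, hxG, hxF⟩ := Finset.exists_of_ssubset
      (Finset.ssubset_iff_subset_ne.2 ⟨h, fun e => hGF (Subtype.ext e).symm⟩)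
    refine iff_of_true (h ha) ?_
    by_contra hbG
    exact absurd (hc.coneLevel_lt hG hxG hbG) (not_lt.2 (hbmin x (Finset.mem_compl.2 hxF)))

/-- The cardinalities of the members of a chain. -/
def coneSizes (c : Finset (ProperSubset n)) : Finset ℕ :=
  c.image fun F => F.1.card

lemma IsCone.card_coneSizes {c : Finset (ProperSubset n)} (hc : IsCone c) :
    (coneSizes c).card = c.card :=
  Finset.card_image_of_injOn hc.card_injOn

lemma coneSizes_subset (c : Finset (ProperSubset n)) : coneSizes c ⊆ Finset.Icc 1 n := by
  intro k hk
  obtain ⟨F, -, rfl⟩ := Finset.mem_image.1 hk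
  exact Finset.mem_Icc.2 ⟨F.card_pos, F.card_le⟩

/-- A maximal chain is the chain of prefixes of exactly one permutation. -/
lemma IsCone.existsUnique_perm {c : Finset (ProperSubset n)} (hc : IsCone c)
    (hcard : c.card = n) :
    ∃! σ : Equiv.Perm (Fin (n + 1)), ∀ F ∈ c, F.1 = prefixSet σ F.1.card := by
  obtain ⟨σ, hσ⟩ := hc.exists_perm
  refine ⟨σ, hσ, fun τ hτ => ?_⟩
  have hs : coneSizes c = Finset.Icc 1 n :=
    Finset.eq_of_subset_of_card_le (coneSizes_subset c) (by simp [hc.card_coneSizes, hcard])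
  have hpre : ∀ k ≤ n + 1, prefixSet σ k = prefixSet τ k := by
    intro k hk
    rcases Nat.eq_zero_or_pos k with rfl | hk0
    · ext a; simp
    rcases Nat.lt_or_ge n k with hkn | hkn
    · ext a; simp; omega
    · have : k ∈ coneSizes c := by rw [hs]; exact Finset.mem_Icc.2 ⟨hk0, hkn⟩
      obtain ⟨F, hF, rfl⟩ := Finset.mem_image.1 this
      exact (hσ F hF).symm.trans (hτ F hF)
  have hsymm : ∀ a, σ.symm a = τ.symm a := by
    intro a
    have h : ∀ k ≤ n + 1, ((σ.symm a : ℕ) < k ↔ (τ.symm a : ℕ) < k) := fun k hk => by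
      rw [← mem_prefixSet, ← mem_prefixSet, hpre k hk]
    have h1 := h (σ.symm a + 1) (by omega)
    have h2 := h (τ.symm a + 1) (by omega)
    ext
    omega
  exact (Equiv.symm_bijective.injective (Equiv.ext hsymm)).symm

/-! ### The degree map -/

/-- The element `σ k`, as a rational number (and `0` if `k > n`). -/
def permValue (σ : Equiv.Perm (Fin (n + 1))) (k : ℕ) : ℚ :=
  if h : k < n + 1 then (((σ ⟨k, h⟩ : Fin (n + 1)) : ℕ) : ℚ) else 0

lemma permValue_symm (σ : Equiv.Perm (Fin (n + 1))) (a : Fin (n + 1)) :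
    permValue σ (σ.symm a : ℕ) = ((a : ℕ) : ℚ) := by
  rw [permValue, dif_pos (σ.symm a).isLt, Fin.eta, Equiv.apply_symm_apply]

/-- Restriction of a class to the torus-fixed point belonging to the maximal cone of `σ`, followed
by evaluation of the equivariant parameters `t_a` at `a`. The rays of that cone are the prefixes
of `σ`, and the linear form dual to the ray of `{σ 0, …, σ (k - 1)}` is `t_{σ (k - 1)} - t_{σ k}`. -/
def evalAt (σ : Equiv.Perm (Fin (n + 1))) : MvPolynomial (ProperSubset n) ℚ →ₐ[ℚ] ℚ :=
  aeval fun F : ProperSubset n =>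
    if F.1 = prefixSet σ F.1.card then permValue σ (F.1.card - 1) - permValue σ F.1.card else 0

/-- The Euler class of the tangent space at the torus-fixed point of `σ`. -/
def eulerAt (σ : Equiv.Perm (Fin (n + 1))) : ℚ :=
  ∏ k ∈ Finset.Icc 1 n, (permValue σ (k - 1) - permValue σ k)

lemma eulerAt_ne_zero (σ : Equiv.Perm (Fin (n + 1))) : eulerAt σ ≠ 0 := by
  refine Finset.prod_ne_zero_iff.2 fun k hk => ?_
  rw [Finset.mem_Icc] at hk
  have h1 : k - 1 < n + 1 := by omega
  have h2 : k < n + 1 := by omega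
  simp only [permValue, h1, h2, dif_pos]
  intro h
  have h' : (σ ⟨k - 1, h1⟩ : Fin (n + 1)) = σ ⟨k, h2⟩ := by
    ext
    exact_mod_cast sub_eq_zero.1 h
  have := σ.injective h'
  rw [Fin.mk.injEq] at this
  omega

/-- The right hand side of the Atiyah–Bott localization formula. -/
def localization (n : ℕ) : MvPolynomial (ProperSubset n) ℚ →ₗ[ℚ] ℚ :=
  ∑ σ : Equiv.Perm (Fin (n + 1)), (eulerAt σ)⁻¹ • (evalAt σ).toLinearMap

lemma localization_apply (f : MvPolynomial (ProperSubset n) ℚ) :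
    localization n f = ∑ σ : Equiv.Perm (Fin (n + 1)), (eulerAt σ)⁻¹ * evalAt σ f := by
  simp [localization]

/-- The linear relation belonging to `a` and `b`. -/
def linForm (a b : Fin (n + 1)) : MvPolynomial (ProperSubset n) ℚ :=
  (∑ F : ProperSubset n, if a ∈ F.1 then X F else 0) -
    (∑ F : ProperSubset n, if b ∈ F.1 then X F else 0)

lemma evalAt_X (σ : Equiv.Perm (Fin (n + 1))) (F : ProperSubset n) :
    evalAt σ (X F) = if F.1 = prefixSet σ F.1.card then
      permValue σ (F.1.card - 1) - permValue σ F.1.card else 0 := by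
  simp [evalAt]

lemma evalAt_sum_mem (σ : Equiv.Perm (Fin (n + 1))) (a : Fin (n + 1)) :
    evalAt σ (∑ F : ProperSubset n, if a ∈ F.1 then X F else 0)
      = ((a : ℕ) : ℚ) - permValue σ n := by
  let e : Fin n → ProperSubset n := fun k => ⟨prefixSet σ (k + 1), by
    constructor
    · rw [← Finset.card_pos, card_prefixSet σ (by omega)]; omega
    · rw [← Finset.card_lt_iff_ne_univ, card_prefixSet σ (by omega), Fintype.card_fin]; omega⟩
  have hcard : ∀ k, (e k).1.card = k + 1 := fun k => card_prefixSet σ (by omega)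
  have he : Function.Injective e := fun k l h => by
    have := congrArg (fun F : ProperSubset n => F.1.card) h
    simp only [hcard] at this
    ext
    omega
  have hsum : ∑ k : Fin n,
      (if (σ.symm a : ℕ) < k + 1 then permValue σ k - permValue σ (k + 1) else 0)
      = ∑ F : ProperSubset n, if a ∈ F.1 then evalAt σ (X F) else 0 := by
    refine Fintype.sum_of_injective e he _ _ (fun F hF => ?_) fun k => ?_
    · rw [evalAt_X, if_neg (c := F.1 = _) (fun h => hF ?_), ite_self]
      have h1 := F.card_pos
      have h2 := F.card_le
      refine ⟨⟨F.1.card - 1, by omega⟩, Subtype.ext ?_⟩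
      change prefixSet σ (F.1.card - 1 + 1) = F.1
      rw [Nat.sub_add_cancel h1]
      exact h.symm
    · rw [evalAt_X, hcard, if_pos (show (e k).1 = _ from rfl)]
      simp [e]
  have htel : ∀ m, m ≤ n → ∑ k ∈ Finset.range m,
      (if (σ.symm a : ℕ) < k + 1 then permValue σ k - permValue σ (k + 1) else 0)
      = if (σ.symm a : ℕ) < m then permValue σ (σ.symm a : ℕ) - permValue σ m else 0 := by
    intro m
    induction m with
    | zero => simp
    | succ m ih =>
      intro hm
      rw [Finset.sum_range_succ, ih (by omega)]
      rcases lt_trichotomy (σ.symm a : ℕ) m with h | h | h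
      · rw [if_pos h, if_pos (by omega), if_pos (by omega)]; ring
      · rw [if_neg (by omega), if_pos (by omega), if_pos (by omega), h]; ring
      · rw [if_neg (by omega), if_neg (by omega), if_neg (by omega)]; ring
  simp only [map_sum, apply_ite (evalAt σ), map_zero]
  rw [← hsum, Fin.sum_univ_eq_sum_range (fun k => if (σ.symm a : ℕ) < k + 1 then
    permValue σ k - permValue σ (k + 1) else 0) n, htel n le_rfl, permValue_symm]
  split_ifs with h
  · rfl
  · have : permValue σ n = permValue σ (σ.symm a : ℕ) := congrArg _ (by omega)
    rw [this, permValue_symm, sub_self]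

lemma evalAt_linForm (σ : Equiv.Perm (Fin (n + 1))) (a b : Fin (n + 1)) :
    evalAt σ (linForm a b) = ((a : ℕ) : ℚ) - ((b : ℕ) : ℚ) := by
  rw [linForm, map_sub, evalAt_sum_mem, evalAt_sum_mem]
  ring

lemma localization_mul_linForm (f : MvPolynomial (ProperSubset n) ℚ) (a b : Fin (n + 1)) :
    localization n (f * linForm a b) = (((a : ℕ) : ℚ) - ((b : ℕ) : ℚ)) * localization n f := by
  simp only [localization_apply, map_mul, evalAt_linForm, Finset.mul_sum]
  exact Finset.sum_congr rfl fun σ _ => by ring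

lemma localization_mul_quadratic (f : MvPolynomial (ProperSubset n) ℚ) {F G : ProperSubset n}
    (h₁ : ¬ F.1 ⊆ G.1) (h₂ : ¬ G.1 ⊆ F.1) : localization n (f * (X F * X G)) = 0 := by
  rw [localization_apply]
  refine Finset.sum_eq_zero fun σ _ => ?_
  rw [map_mul, map_mul, evalAt_X, evalAt_X]
  split_ifs with hF hG
  · rcases le_total F.1.card G.1.card with h | h
    · exact absurd (hF ▸ hG ▸ prefixSet_mono σ h) h₁
    · exact absurd (hF ▸ hG ▸ prefixSet_mono σ h) h₂
  all_goals simp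

/-- The monomial of a cone. -/
def coneMonomial (c : Finset (ProperSubset n)) : MvPolynomial (ProperSubset n) ℚ :=
  ∏ F ∈ c, X F

lemma localization_coneMonomial_of_card_eq {c : Finset (ProperSubset n)} (hc : IsCone c)
    (hcard : c.card = n) : localization n (coneMonomial c) = 1 := by
  obtain ⟨σ, hσ, hu⟩ := hc.existsUnique_perm hcard
  rw [localization_apply, Finset.sum_eq_single σ]
  · have hs : coneSizes c = Finset.Icc 1 n :=
      Finset.eq_of_subset_of_card_le (coneSizes_subset c) (by simp [hc.card_coneSizes, hcard])
    have : evalAt σ (coneMonomial c) = eulerAt σ := by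
      rw [coneMonomial, map_prod, eulerAt, ← hs, coneSizes, Finset.prod_image hc.card_injOn]
      exact Finset.prod_congr rfl fun F hF => by rw [evalAt_X, if_pos (hσ F hF)]
    rw [this, inv_mul_cancel₀ (eulerAt_ne_zero σ)]
  · intro τ _ hτ
    have : ∃ F ∈ c, F.1 ≠ prefixSet τ F.1.card := by
      by_contra! h
      exact hτ (hu τ h)
    obtain ⟨F, hF, hne⟩ := this
    rw [coneMonomial, map_prod, Finset.prod_eq_zero hF (by rw [evalAt_X, if_neg hne]), mul_zero]
  · simp

/-- The action of a permutation of the ground set on the nonempty proper subsets. -/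
def permSubset (π : Equiv.Perm (Fin (n + 1))) : Equiv.Perm (ProperSubset n) where
  toFun F := ⟨F.1.map π.toEmbedding, by simpa using F.2.1, fun h => F.2.2 (by
    rw [← Finset.card_eq_iff_eq_univ] at h ⊢; simpa using h)⟩
  invFun F := ⟨F.1.map π.symm.toEmbedding, by simpa using F.2.1, fun h => F.2.2 (by
    rw [← Finset.card_eq_iff_eq_univ] at h ⊢; simpa using h)⟩
  left_inv F := by ext a; simp
  right_inv F := by ext a; simp

lemma mem_permSubset {π : Equiv.Perm (Fin (n + 1))} {F : ProperSubset n} {a : Fin (n + 1)} :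
    a ∈ (permSubset π F).1 ↔ π.symm a ∈ F.1 := by
  simp [permSubset]

lemma permSubset_swap_eq {a b : Fin (n + 1)} {F : ProperSubset n} (h : a ∈ F.1 ↔ b ∈ F.1) :
    permSubset (Equiv.swap a b) F = F := by
  ext x
  rw [mem_permSubset, Equiv.symm_swap, Equiv.swap_apply_def]
  split_ifs with h1 h2
  · rw [h1, h]
  · rw [h2, h]
  · rfl

lemma permSubset_subset {π : Equiv.Perm (Fin (n + 1))} {F G : ProperSubset n} :
    (permSubset π F).1 ⊆ (permSubset π G).1 ↔ F.1 ⊆ G.1 := by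
  simp [permSubset]

lemma localization_mul_linForm_eq_sum (f : MvPolynomial (ProperSubset n) ℚ)
    (a b : Fin (n + 1)) :
    localization n (f * linForm a b)
      = (∑ F : ProperSubset n, if a ∈ F.1 then localization n (X F * f) else 0)
        - ∑ F : ProperSubset n, if b ∈ F.1 then localization n (X F * f) else 0 := by
  rw [mul_comm]
  simp only [linForm, sub_mul, Finset.sum_mul, ite_mul, zero_mul, map_sub, map_sum,
    apply_ite (localization n), map_zero]

/-- The localization sum vanishes on the monomial of a cone that is not maximal: multiplication
with the linear relation of two elements that the cone does not separate gives, by descending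
induction on the dimension, a sum that is symmetric in these two elements. -/
lemma localization_coneMonomial_of_card_lt {c : Finset (ProperSubset n)} (hc : IsCone c)
    (hcard : c.card < n) : localization n (coneMonomial c) = 0 := by
  induction hk : n - c.card using Nat.strong_induction_on generalizing c with
  | _ k ih =>
  obtain ⟨a, b, hab, hsep⟩ := hc.exists_not_separated hcard
  have hval : ∀ F : ProperSubset n, F ∉ c → localization n (X F * coneMonomial c)
      = if (∀ G ∈ c, F.1 ⊆ G.1 ∨ G.1 ⊆ F.1) ∧ c.card + 1 = n then 1 else 0 := by
    intro F hF
    by_cases hcomp : ∀ G ∈ c, F.1 ⊆ G.1 ∨ G.1 ⊆ F.1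
    · have hins : X F * coneMonomial c = coneMonomial (insert F c) := by
        rw [coneMonomial, coneMonomial, Finset.prod_insert hF]
      have hcard' := Finset.card_insert_of_notMem hF
      rw [hins]
      by_cases hn : c.card + 1 = n
      · rw [if_pos ⟨hcomp, hn⟩,
          localization_coneMonomial_of_card_eq (hc.insert hcomp) (by omega)]
      · rw [if_neg (fun h => hn h.2)]
        exact ih _ (by omega) (hc.insert hcomp) (by omega) rfl
    · rw [if_neg (fun h => hcomp h.1)]
      push Not at hcomp
      obtain ⟨G, hG, h1, h2⟩ := hcomp
      have : X F * coneMonomial c = (∏ H ∈ c.erase G, X H) * (X F * X G) := by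
        rw [coneMonomial, ← Finset.prod_erase_mul _ _ hG]
        ring
      rw [this, localization_mul_quadratic _ h1 h2]
  have hzero : localization n (coneMonomial c * linForm a b) = 0 := by
    rw [localization_mul_linForm_eq_sum, sub_eq_zero]
    refine Fintype.sum_equiv (permSubset (Equiv.swap a b)) _ _ fun F => ?_
    have hmem : b ∈ (permSubset (Equiv.swap a b) F).1 ↔ a ∈ F.1 := by
      rw [mem_permSubset, Equiv.symm_swap, Equiv.swap_apply_right]
    have hfix : ∀ G ∈ c, permSubset (Equiv.swap a b) G = G := fun G hG =>
      permSubset_swap_eq (hsep G hG)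
    simp only [hmem]
    refine ite_congr rfl (fun _ => ?_) fun _ => rfl
    by_cases hF : F ∈ c
    · rw [hfix F hF]
    · have hF' : permSubset (Equiv.swap a b) F ∉ c := fun h => by
        have := hfix _ h
        rw [(permSubset (Equiv.swap a b)).injective this] at h
        exact hF h
      rw [hval F hF, hval _ hF']
      refine if_congr (and_congr_left fun _ => forall₂_congr fun G hG => ?_) rfl rfl
      have h1 := permSubset_subset (π := Equiv.swap a b) (F := F) (G := G)
      have h2 := permSubset_subset (π := Equiv.swap a b) (F := G) (G := F)
      rw [hfix G hG] at h1 h2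
      rw [h1, h2]
  rw [localization_mul_linForm, mul_eq_zero, sub_eq_zero] at hzero
  rcases hzero with h | h
  · exact absurd (Fin.ext (by exact_mod_cast h)) hab
  · exact h

/-- The localization sum vanishes on all monomials of degree less than `n`: modulo the linear
relations these are combinations of monomials of cones. -/
lemma localization_eq_zero_of_lt (d : ℕ) (hd : d < n) {c : Finset (ProperSubset n)}
    (hc : IsCone c) (m : Multiset (ProperSubset n)) (hm : c.card + m.card = d) :
    localization n (coneMonomial c * (m.map X).prod) = 0 := by
  induction d using Nat.strong_induction_on generalizing c m with
  | _ d ihd =>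
  induction hk : m.card generalizing c m with
  | zero =>
    rw [Multiset.card_eq_zero] at hk
    subst hk
    simpa using localization_coneMonomial_of_card_lt hc (by simpa using hm.trans_lt hd)
  | succ k ihk =>
    obtain ⟨F, hFm⟩ := Multiset.card_pos_iff_exists_mem.1 (by omega : 0 < m.card)
    obtain ⟨m, rfl⟩ := Multiset.exists_cons_of_mem hFm
    rw [Multiset.card_cons] at hk hm
    have hnew : ∀ G ∉ c, localization n (X G * (coneMonomial c * (m.map X).prod)) = 0 := by
      intro G hG
      by_cases hcomp : ∀ H ∈ c, G.1 ⊆ H.1 ∨ H.1 ⊆ G.1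
      · have hins : X G * (coneMonomial c * (m.map X).prod)
            = coneMonomial (insert G c) * (m.map X).prod := by
          rw [coneMonomial, coneMonomial, Finset.prod_insert hG, mul_assoc]
        have hcard' := Finset.card_insert_of_notMem hG
        rw [hins]
        exact ihk (hc.insert hcomp) m (by omega) (by omega)
      · push Not at hcomp
        obtain ⟨H, hH, h1, h2⟩ := hcomp
        have : X G * (coneMonomial c * (m.map X).prod)
            = ((∏ H ∈ c.erase H, X H) * (m.map X).prod) * (X G * X H) := by
          rw [coneMonomial, ← Finset.prod_erase_mul _ _ hH]
          ring
        rw [this, localization_mul_quadratic _ h1 h2]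
    rw [Multiset.map_cons, Multiset.prod_cons, mul_left_comm]
    by_cases hF : F ∈ c
    · obtain ⟨a, ha, b, hb, hsep⟩ := hc.exists_separated hF
      have hlin := localization_mul_linForm (coneMonomial c * (m.map X).prod) a b
      rw [ihd (d - 1) (by omega) (by omega) hc m (by omega), mul_zero,
        localization_mul_linForm_eq_sum, ← Finset.sum_sub_distrib, Finset.sum_eq_single F,
        if_pos ha, if_neg hb, sub_zero] at hlin
      · exact hlin
      · intro G _ hG
        by_cases hGc : G ∈ c
        · simp [hsep G hGc hG]
        · simp [hnew G hGc]
      · simp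
    · exact hnew F hF

lemma localization_monomial_eq_zero (s : ProperSubset n →₀ ℕ) (a : ℚ) (hs : s.degree < n) :
    localization n (monomial s a) = 0 := by
  have h := localization_eq_zero_of_lt s.degree hs (c := ∅) (by simp [IsCone]) s.toMultiset
    (by rw [Finsupp.card_toMultiset, Finset.card_empty, zero_add]; rfl)
  have hX : ((Finsupp.toMultiset s).map (X : _ → MvPolynomial (ProperSubset n) ℚ)).prod
      = monomial s 1 := by
    rw [Finsupp.toMultiset_map, Finsupp.prod_toMultiset, Finsupp.prod_mapDomain_index
      (by simp) (by intros; rw [pow_add]), monomial_eq, C_1, one_mul]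
  rw [coneMonomial, Finset.prod_empty, one_mul, hX] at h
  rw [← mul_one a, ← smul_eq_mul, ← smul_monomial, map_smul, h, smul_zero]

/-- The degree of a polynomial in the divisor classes: the localization sum of its part of
degree `n`. -/
def polyDegree (n : ℕ) : MvPolynomial (ProperSubset n) ℚ →ₗ[ℚ] ℚ :=
  localization n ∘ₗ homogeneousComponent n

lemma isHomogeneous_linForm (a b : Fin (n + 1)) : (linForm a b).IsHomogeneous 1 := by
  refine IsHomogeneous.sub ?_ ?_ <;>
  · refine IsHomogeneous.sum _ _ _ fun F _ => ?_
    split_ifs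
    · exact isHomogeneous_X _ _
    · exact isHomogeneous_zero _ _ _

lemma polyDegree_mul_eq_zero {f : MvPolynomial (ProperSubset n) ℚ}
    (hf : f ∈ relationIdeal n) : ∀ g, polyDegree n (g * f) = 0 := by
  rw [relationIdeal, ← Ideal.span_union] at hf
  refine Submodule.span_induction (p := fun f _ => ∀ g, polyDegree n (g * f) = 0)
    ?_ (by simp) (fun x y _ _ hx hy g => by rw [mul_add, map_add, hx, hy, add_zero])
    (fun a x _ hx g => by rw [smul_eq_mul, ← mul_assoc, hx]) hf
  rintro f (⟨a, b, hab⟩ | ⟨F, G, h1, h2, rfl⟩) g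
  · replace hab : f = linForm a b := hab
    subst hab
    induction g using MvPolynomial.induction_on' with
    | monomial s r =>
      have hh := (isHomogeneous_monomial r (n := s.degree) rfl).mul (isHomogeneous_linForm a b)
      rw [polyDegree, LinearMap.comp_apply, homogeneousComponent_of_mem
        ((mem_homogeneousSubmodule _ _).2 hh)]
      split_ifs with hd
      · rw [localization_mul_linForm, localization_monomial_eq_zero s r (by omega), mul_zero]
      · rw [map_zero]
    | add p q hp hq => rw [add_mul, map_add, hp, hq, add_zero]
  · induction g using MvPolynomial.induction_on' with
    | monomial s r =>
      have hh := (isHomogeneous_monomial r (n := s.degree) rfl).mul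
        ((isHomogeneous_X ℚ F).mul (isHomogeneous_X ℚ G))
      rw [polyDegree, LinearMap.comp_apply, homogeneousComponent_of_mem
        ((mem_homogeneousSubmodule _ _).2 hh)]
      split_ifs with hd
      · rw [localization_mul_quadratic _ h1 h2]
      · rw [map_zero]
    | add p q hp hq => rw [add_mul, map_add, hp, hq, add_zero]

theorem exists_isDegreeMap (n : ℕ) : ∃ φ : Chow n →ₗ[ℚ] ℚ, IsDegreeMap φ := by
  refine ⟨Submodule.liftQ ((relationIdeal n).restrictScalars ℚ) (polyDegree n) fun f hf => ?_,
    fun c hc => ?_⟩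
  · simpa using polyDegree_mul_eq_zero hf 1
  · have hmk : coneClass c = Ideal.Quotient.mk (relationIdeal n) (coneMonomial c) := by
      simp [coneClass, coneMonomial, divisorClass]
    rw [hmk]
    change polyDegree n (coneMonomial c) = _
    have hh : (coneMonomial c).IsHomogeneous c.card := by
      simpa [coneMonomial] using IsHomogeneous.prod c (fun F => (X F : MvPolynomial (ProperSubset n) ℚ))
        (fun _ => 1) fun F _ => isHomogeneous_X ℚ F
    rw [polyDegree, LinearMap.comp_apply, homogeneousComponent_of_mem
      ((mem_homogeneousSubmodule _ _).2 hh)]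
    by_cases h : c.card = n
    · rw [if_pos h, if_pos h.symm, localization_coneMonomial_of_card_eq hc h]
    · rw [if_neg h, if_neg (Ne.symm h), map_zero]

lemma isDegreeMap_degreeMap (n : ℕ) : IsDegreeMap (degreeMap n) := by
  rw [degreeMap, dif_pos (exists_isDegreeMap n)]
  exact (exists_isDegreeMap n).choose_spec

/-! ### Monomials in a sequence and in its second antidifference -/

/-- A sequence with zero boundary values that is affine around each of its nonzero members is
zero: each member is a multiple of its successor by a factor in `[0, 1)`. -/
lemma eq_zero_of_affine {V : Type*} [AddCommGroup V] [Module ℚ V] (z : ℕ → V) (N : ℕ)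
    (h0 : z 0 = 0) (hN : z (N + 1) = 0)
    (h : ∀ m < N, z (m + 1) = 0 ∨ (2 : ℚ) • z (m + 1) = z m + z (m + 2)) :
    ∀ m ≤ N + 1, z m = 0 := by
  have hstep : ∀ m ≤ N, ∃ q : ℚ, 0 ≤ q ∧ q < 1 ∧ z m = q • z (m + 1) := by
    intro m
    induction m with
    | zero => exact fun _ => ⟨0, le_rfl, one_pos, by rw [h0, zero_smul]⟩
    | succ m ih =>
      intro hm
      rcases h m (by omega) with hz | hz
      · exact ⟨0, le_rfl, one_pos, by rw [hz, zero_smul]⟩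
      · obtain ⟨q, hq0, hq1, hq⟩ := ih (by omega)
        have hpos : (0 : ℚ) < 2 - q := by linarith
        refine ⟨(2 - q)⁻¹, by positivity, inv_lt_one_of_one_lt₀ (by linarith), ?_⟩
        rw [eq_inv_smul_iff₀ hpos.ne', sub_smul, hz, hq]
        abel
  intro m hm
  induction hk : N + 1 - m generalizing m with
  | zero => rwa [show m = N + 1 by omega]
  | succ k ih =>
    obtain ⟨q, -, -, hq⟩ := hstep m (by omega)
    rw [hq, ih (m + 1) (by omega) (by omega), smul_zero]

section SecondDifference

variable {R : Type*} [CommRing R] [Algebra ℚ R] {y l : ℕ → R}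

/-- The relations between the symmetric divisor classes `y k` and the hypersimplex classes `l m`
of the permutohedral variety: `y` is the negative of the second difference of `l`, which vanishes
at `0` and `n + 1`, and `l m * y m = 0`. -/
structure IsHypersimplexPair (n : ℕ) (y l : ℕ → R) : Prop where
  zero : l 0 = 0
  last : l (n + 1) = 0
  mul : ∀ m, l m * y m = 0
  succ : ∀ m, y (m + 1) = (2 : ℚ) • l (m + 1) - l m - l (m + 2)

/-- The span of `y 1, …, y n`. -/
def spanIcc (n : ℕ) (y : ℕ → R) : Submodule ℚ R :=
  Submodule.span ℚ (y '' Finset.Icc 1 n)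

/-- The span of the squarefree monomials of degree `r` in `y 1, …, y n`. -/
def squarefreeSpan (n : ℕ) (y : ℕ → R) (r : ℕ) : Submodule ℚ R :=
  Submodule.span ℚ {u | ∃ K ⊆ Finset.Icc 1 n, K.card = r ∧ u = ∏ k ∈ K, y k}

/-- The span of the monomials of degree `r` in `l n, …, l 1`. -/
def monomialSpan (n : ℕ) (l : ℕ → R) (r : ℕ) : Submodule ℚ R :=
  Submodule.span ℚ {u | ∃ a : Fin n → ℕ, ∑ i, a i = r ∧ u = ∏ i : Fin n, l (n - i) ^ a i}

lemma mem_spanIcc {k : ℕ} (h1 : 1 ≤ k) (hk : k ≤ n) : y k ∈ spanIcc n y :=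
  Submodule.subset_span ⟨k, by simp [h1, hk], rfl⟩

namespace IsHypersimplexPair

lemma mem (h : IsHypersimplexPair n y l) {m : ℕ} (hm : m ≤ n + 1) : l m ∈ spanIcc n y := by
  rw [← Submodule.Quotient.mk_eq_zero]
  refine eq_zero_of_affine
    (fun m => (Submodule.Quotient.mk (l m) : _ ⧸ spanIcc n y)) n
    (by simp [h.zero]) (by simp [h.last]) (fun m hm => Or.inr ?_) m hm
  have := mem_spanIcc (n := n) (y := y) (k := m + 1) (by omega) (by omega)
  rw [h.succ, ← Submodule.Quotient.mk_eq_zero] at this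
  simp only [Submodule.Quotient.mk_sub, Submodule.Quotient.mk_smul] at this
  rw [← sub_eq_zero, ← this]
  abel

/-- Multiplying a squarefree monomial with one of the `y k` gives a combination of squarefree
monomials: modulo these, the sequence of its products with the `l m` vanishes at the factors of
the monomial and is affine elsewhere. -/
lemma prod_mul_mem (h : IsHypersimplexPair n y l) (T : Finset ℕ) {u : R} (hu : u ∈ spanIcc n y) :
    (∏ k ∈ T, y k) * u ∈ Submodule.span ℚ
      {v | ∃ k ∈ Finset.Icc 1 n, k ∉ T ∧ v = ∏ j ∈ insert k T, y j} := by
  set W : Submodule ℚ R := Submodule.span ℚ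
      {v | ∃ k ∈ Finset.Icc 1 n, k ∉ T ∧ v = ∏ j ∈ insert k T, y j} with hW
  set P : R := ∏ k ∈ T, y k with hP
  have hnew : ∀ k ∈ Finset.Icc 1 n, k ∉ T → P * y k ∈ W := fun k hk hkT =>
    Submodule.subset_span ⟨k, hk, hkT, by rw [Finset.prod_insert hkT, mul_comm]⟩
  have hL : ∀ m ≤ n + 1, P * l m ∈ W := by
    intro m hm
    rw [← Submodule.Quotient.mk_eq_zero]
    refine eq_zero_of_affine
      (fun m => (Submodule.Quotient.mk (P * l m) : _ ⧸ W)) n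
      (by simp [h.zero]) (by simp [h.last]) (fun m hm => ?_) m hm
    by_cases hmT : m + 1 ∈ T
    · left
      rw [hP, ← Finset.prod_erase_mul _ _ hmT, mul_assoc, mul_comm (y (m + 1)),
        h.mul, mul_zero, Submodule.Quotient.mk_zero]
    · right
      have := hnew (m + 1) (by simp; omega) hmT
      rw [h.succ, mul_sub, mul_sub, mul_smul_comm, ← Submodule.Quotient.mk_eq_zero] at this
      simp only [Submodule.Quotient.mk_sub, Submodule.Quotient.mk_smul] at this
      rw [← sub_eq_zero, ← this]
      abel
  refine Submodule.span_induction (p := fun u _ => P * u ∈ W) ?_ (by simp)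
    (fun x y _ _ hx hy => by rw [mul_add]; exact W.add_mem hx hy)
    (fun a x _ hx => by rw [mul_smul_comm]; exact W.smul_mem a hx) hu
  rintro _ ⟨k, hk, rfl⟩
  rw [Finset.mem_coe] at hk
  by_cases hkT : k ∈ T
  · rw [Finset.mem_Icc] at hk
    obtain ⟨m, rfl⟩ : ∃ m, k = m + 1 := ⟨k - 1, by omega⟩
    rw [h.succ, mul_sub, mul_sub, mul_smul_comm]
    exact W.sub_mem (W.sub_mem (W.smul_mem _ (hL _ (by omega))) (hL _ (by omega)))
      (hL _ (by omega))
  · exact hnew k hk hkT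

lemma prod_mul_pow_mem (h : IsHypersimplexPair n y l) (e : ℕ) {T : Finset ℕ}
    (hT : T ⊆ Finset.Icc 1 n) {u : R} (hu : u ∈ spanIcc n y ^ e) :
    (∏ k ∈ T, y k) * u ∈ squarefreeSpan n y (T.card + e) := by
  induction e generalizing T u with
  | zero =>
    rw [pow_zero] at hu
    obtain ⟨q, rfl⟩ := Submodule.mem_one.1 hu
    rw [← Algebra.commutes, ← Algebra.smul_def]
    exact Submodule.smul_mem _ _ (Submodule.subset_span ⟨T, hT, rfl, rfl⟩)
  | succ e ih =>
    rw [pow_succ'] at hu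
    refine Submodule.mul_induction_on hu (fun x hx z hz => ?_) fun x z hx hz => by
      rw [mul_add]; exact Submodule.add_mem _ hx hz
    rw [← mul_assoc]
    refine Submodule.span_induction
      (p := fun v _ => v * z ∈ squarefreeSpan n y (T.card + (e + 1))) ?_ (by simp)
      (fun x y _ _ hx hy => by rw [add_mul]; exact Submodule.add_mem _ hx hy)
      (fun a x _ hx => by rw [smul_mul_assoc]; exact Submodule.smul_mem _ a hx)
      (h.prod_mul_mem T hx)
    rintro _ ⟨k, hk, hkT, rfl⟩
    have := ih (Finset.insert_subset hk hT) hz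
    rwa [Finset.card_insert_of_notMem hkT, add_assoc, add_comm 1 e] at this

lemma pow_eq_squarefreeSpan (h : IsHypersimplexPair n y l) (r : ℕ) :
    spanIcc n y ^ r = squarefreeSpan n y r := by
  refine le_antisymm (fun u hu => ?_) (Submodule.span_le.2 ?_)
  · simpa using h.prod_mul_pow_mem r (T := ∅) (by simp) hu
  · rintro _ ⟨K, hK, rfl, rfl⟩
    induction K using Finset.induction_on with
    | empty => simpa using Submodule.one_le.1 (le_refl (1 : Submodule ℚ R))
    | insert k K hk ih =>
      rw [Finset.prod_insert hk, Finset.card_insert_of_notMem hk, pow_succ']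
      have := Finset.mem_Icc.1 (hK (Finset.mem_insert_self k K))
      exact Submodule.mul_mem_mul (mem_spanIcc this.1 this.2)
        (ih fun x hx => hK (Finset.mem_insert_of_mem hx))

lemma monomialSpan_mul_mem (h : IsHypersimplexPair n y l) {r m : ℕ} {u : R}
    (hu : u ∈ monomialSpan n l r) (hm : m ≤ n + 1) : u * l m ∈ monomialSpan n l (r + 1) := by
  refine Submodule.span_induction (p := fun u _ => u * l m ∈ monomialSpan n l (r + 1)) ?_ (by simp)
    (fun x y _ _ hx hy => by rw [add_mul]; exact Submodule.add_mem _ hx hy)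
    (fun a x _ hx => by rw [smul_mul_assoc]; exact Submodule.smul_mem _ a hx) hu
  rintro _ ⟨a, ha, rfl⟩
  rcases Nat.eq_zero_or_pos m with rfl | hm0
  · simp [h.zero]
  rcases Nat.lt_or_ge n m with hmn | hmn
  · rw [show m = n + 1 by omega, h.last, mul_zero]
    exact Submodule.zero_mem _
  let i : Fin n := ⟨n - m, by omega⟩
  have hi : n - (i : ℕ) = m := by simp only [i]; omega
  refine Submodule.subset_span ⟨a + Pi.single i 1, by simp [Finset.sum_add_distrib, ha], ?_⟩
  simp only [Pi.add_apply, pow_add, Finset.prod_mul_distrib]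
  congr 1
  rw [Finset.prod_eq_single i (fun j _ hj => by simp [hj]) (by simp), hi]
  simp

lemma pow_eq_monomialSpan (h : IsHypersimplexPair n y l) (r : ℕ) :
    spanIcc n y ^ r = monomialSpan n l r := by
  refine le_antisymm ?_ (Submodule.span_le.2 ?_)
  · induction r with
    | zero =>
      rw [pow_zero, Submodule.one_le]
      exact Submodule.subset_span ⟨0, by simp, by simp⟩
    | succ r ih =>
      rw [pow_succ, Submodule.mul_le]
      intro u hu v hv
      refine Submodule.span_induction
        (p := fun v _ => u * v ∈ monomialSpan n l (r + 1)) ?_ (by simp)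
        (fun x y _ _ hx hy => by rw [mul_add]; exact Submodule.add_mem _ hx hy)
        (fun a x _ hx => by rw [mul_smul_comm]; exact Submodule.smul_mem _ a hx) hv
      rintro _ ⟨k, hk, rfl⟩
      rw [Finset.mem_coe, Finset.mem_Icc] at hk
      obtain ⟨m, rfl⟩ : ∃ m, k = m + 1 := ⟨k - 1, by omega⟩
      have hL : ∀ m ≤ n + 1, u * l m ∈ monomialSpan n l (r + 1) :=
        fun m hm => h.monomialSpan_mul_mem (ih hu) hm
      rw [h.succ, mul_sub, mul_sub, mul_smul_comm]
      exact Submodule.sub_mem _ (Submodule.sub_mem _ (Submodule.smul_mem _ _ (hL _ (by omega)))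
        (hL _ (by omega))) (hL _ (by omega))
  · rintro _ ⟨a, rfl, rfl⟩
    have : ∀ s : Finset (Fin n), ∏ i ∈ s, l (n - i) ^ a i ∈ spanIcc n y ^ ∑ i ∈ s, a i := by
      intro s
      induction s using Finset.induction_on with
      | empty => simpa using Submodule.one_le.1 (le_refl (1 : Submodule ℚ R))
      | insert i s hi ih =>
        rw [Finset.prod_insert hi, Finset.sum_insert hi, pow_add]
        exact Submodule.mul_mem_mul (Submodule.pow_mem_pow _ (h.mem (by omega)) _) ih
    exact this Finset.univ

/-- Linear forms agree on the monomials of degree `r` in the `l m` if and only if they agree on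
the squarefree monomials of degree `r` in the `y k`. -/
lemma forall_monomial_iff (h : IsHypersimplexPair n y l) (φ ψ : R →ₗ[ℚ] ℚ) (r : ℕ) :
    (∀ a : Fin n → ℕ, ∑ i, a i = r →
        φ (∏ i : Fin n, l (n - i) ^ a i) = ψ (∏ i : Fin n, l (n - i) ^ a i)) ↔
      ∀ K ⊆ Finset.Icc 1 n, K.card = r → φ (∏ k ∈ K, y k) = ψ (∏ k ∈ K, y k) := by
  have hspan : squarefreeSpan n y r = monomialSpan n l r := by
    rw [← h.pow_eq_squarefreeSpan, h.pow_eq_monomialSpan]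
  constructor
  · intro H K hK hr
    have hle : monomialSpan n l r ≤ LinearMap.eqLocus φ ψ :=
      Submodule.span_le.2 (by rintro _ ⟨a, ha, rfl⟩; exact H a ha)
    exact hle (hspan ▸ Submodule.subset_span ⟨K, hK, hr, rfl⟩)
  · intro H a ha
    have hle : squarefreeSpan n y r ≤ LinearMap.eqLocus φ ψ :=
      Submodule.span_le.2 (by rintro _ ⟨K, hK, hr, rfl⟩; exact H K hK hr)
    exact hle (hspan ▸ Submodule.subset_span ⟨a, ha, rfl⟩)

end IsHypersimplexPair

end SecondDifference

/-! ### The subring generated by the symmetric divisor classes -/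

lemma divisorClass_mul_eq_zero {F G : ProperSubset n} (h₁ : ¬ F.1 ⊆ G.1) (h₂ : ¬ G.1 ⊆ F.1) :
    divisorClass F * divisorClass G = 0 := by
  rw [divisorClass, divisorClass, ← map_mul, Ideal.Quotient.eq_zero_iff_mem]
  exact Ideal.mem_sup_right (Ideal.subset_span ⟨F, G, h₁, h₂, rfl⟩)

lemma divisorClass_mul_coneClass_eq_zero {F : ProperSubset n} {c : Finset (ProperSubset n)}
    (h : ¬ ∀ G ∈ c, F.1 ⊆ G.1 ∨ G.1 ⊆ F.1) : divisorClass F * coneClass c = 0 := by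
  push Not at h
  obtain ⟨G, hG, h1, h2⟩ := h
  rw [coneClass, ← Finset.mul_prod_erase _ _ hG, ← mul_assoc, divisorClass_mul_eq_zero h1 h2,
    zero_mul]

lemma divisorClass_mul_coneClass {F : ProperSubset n} {c : Finset (ProperSubset n)}
    (h : F ∉ c) : divisorClass F * coneClass c = coneClass (insert F c) := by
  rw [coneClass, coneClass, Finset.prod_insert h]

/-- The linear relations: the sum of the `x_F` with `a ∈ F` does not depend on `a`. -/
lemma sum_divisorClass_mem (a b : Fin (n + 1)) :
    (∑ F : ProperSubset n, if a ∈ F.1 then divisorClass F else 0)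
      = ∑ F : ProperSubset n, if b ∈ F.1 then divisorClass F else 0 := by
  have h : Ideal.Quotient.mk (relationIdeal n) (linForm a b) = 0 :=
    Ideal.Quotient.eq_zero_iff_mem.2 (Ideal.mem_sup_left (Ideal.subset_span ⟨a, b, rfl⟩))
  simp only [linForm, map_sub, map_sum, apply_ite (Ideal.Quotient.mk (relationIdeal n)),
    map_zero, sub_eq_zero] at h
  exact h

/-- The sum of the divisor classes `x_F` with `|F| = k`. -/
def sizeClass (n k : ℕ) : Chow n :=
  ∑ F : ProperSubset n, if F.1.card = k then divisorClass F else 0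

/-- The class `L_{n + 1 - m}`. The indices `m = 0` and `m = n + 1`, where it vanishes, are
included as boundary values. -/
def hypersimplexClass (n m : ℕ) : Chow n :=
  ∑ F : ProperSubset n,
    (((min m F.1.card : ℕ) : ℚ) - if Fin.last n ∈ F.1 then (m : ℚ) else 0) • divisorClass F

lemma hypersimplexDivisor_eq {i : ℕ} (hi : i ≤ n + 1) :
    hypersimplexDivisor n i = hypersimplexClass n (n + 1 - i) := by
  refine Finset.sum_congr rfl fun F _ => congrArg (· • divisorClass F) ?_
  rw [hypersimplexCoeff]
  push_cast [Nat.cast_sub hi]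
  split_ifs <;> ring

/-- The class `hypersimplexClass n m` is represented by the piecewise linear function
`S ↦ min m |S| - |S ∩ A|` for each set `A` of cardinality `m`. -/
lemma hypersimplexClass_eq {m : ℕ} (A : Finset (Fin (n + 1))) (hA : A.card = m) :
    hypersimplexClass n m = ∑ F : ProperSubset n,
      (((min m F.1.card : ℕ) : ℚ) - ((F.1 ∩ A).card : ℚ)) • divisorClass F := by
  have h : ∑ F : ProperSubset n, ((F.1 ∩ A).card : ℚ) • divisorClass F
      = ∑ F : ProperSubset n, (if Fin.last n ∈ F.1 then (m : ℚ) else 0) • divisorClass F := by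
    calc ∑ F : ProperSubset n, ((F.1 ∩ A).card : ℚ) • divisorClass F
        = ∑ F : ProperSubset n, ∑ a ∈ A, if a ∈ F.1 then divisorClass F else 0 := by
          refine Finset.sum_congr rfl fun F _ => ?_
          rw [← Finset.sum_filter, Finset.sum_const, Finset.inter_comm,
            ← Finset.filter_mem_eq_inter, Nat.cast_smul_eq_nsmul]
      _ = ∑ a ∈ A, ∑ F : ProperSubset n, if Fin.last n ∈ F.1 then divisorClass F else 0 := by
          rw [Finset.sum_comm]
          exact Finset.sum_congr rfl fun a _ => sum_divisorClass_mem a _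
      _ = _ := by
          rw [Finset.sum_const, hA, Finset.smul_sum]
          refine Finset.sum_congr rfl fun F _ => ?_
          split_ifs
          · rw [Nat.cast_smul_eq_nsmul]
          · simp
  simp only [hypersimplexClass, sub_smul, Finset.sum_sub_distrib, h]

lemma hypersimplexClass_zero : hypersimplexClass n 0 = 0 := by
  simp [hypersimplexClass]

lemma hypersimplexClass_last : hypersimplexClass n (n + 1) = 0 := by
  rw [hypersimplexClass_eq Finset.univ (by simp)]
  refine Finset.sum_eq_zero fun F _ => ?_
  rw [Finset.inter_univ, min_eq_right (F.card_le.trans n.le_succ), sub_self, zero_smul]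

/-- The hypersimplex of type `m` has a single vertex as its face in the direction of a set of
cardinality `m`; therefore its class restricts to zero on the divisor of such a set. -/
lemma hypersimplexClass_mul_sizeClass (m : ℕ) :
    hypersimplexClass n m * sizeClass n m = 0 := by
  rw [sizeClass, Finset.mul_sum]
  refine Finset.sum_eq_zero fun F _ => ?_
  split_ifs with hF
  · rw [hypersimplexClass_eq F.1 hF, Finset.sum_mul]
    refine Finset.sum_eq_zero fun G _ => ?_
    rw [smul_mul_assoc]
    by_cases h1 : G.1 ⊆ F.1
    · have := Finset.card_le_card h1
      rw [Finset.inter_eq_left.2 h1, min_eq_right (hF ▸ this), sub_self, zero_smul]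
    by_cases h2 : F.1 ⊆ G.1
    · have := Finset.card_le_card h2
      rw [Finset.inter_eq_right.2 h2, min_eq_left (hF ▸ this), hF, sub_self, zero_smul]
    · rw [divisorClass_mul_eq_zero h1 h2, smul_zero]
  · rw [mul_zero]

/-- The classes `sizeClass n k` are the second differences of the classes
`hypersimplexClass n m`. -/
lemma sizeClass_succ_eq (m : ℕ) : sizeClass n (m + 1) = (2 : ℚ) • hypersimplexClass n (m + 1)
    - hypersimplexClass n m - hypersimplexClass n (m + 2) := by
  simp only [sizeClass, hypersimplexClass, Finset.smul_sum, smul_smul, ← Finset.sum_sub_distrib,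
    ← sub_smul]
  refine Finset.sum_congr rfl fun F _ => ?_
  rcases lt_trichotomy F.1.card (m + 1) with h | h | h
  · rw [if_neg h.ne, min_eq_right h.le, min_eq_right (by omega), min_eq_right (by omega)]
    symm
    convert zero_smul ℚ (divisorClass F)
    push_cast
    split_ifs <;> ring
  · rw [if_pos h, min_eq_right h.le, min_eq_left (by omega), min_eq_right (by omega), h]
    symm
    convert one_smul ℚ (divisorClass F)
    push_cast
    split_ifs <;> ring
  · rw [if_neg h.ne', min_eq_left h.le, min_eq_left (by omega), min_eq_left (by omega)]
    symm
    convert zero_smul ℚ (divisorClass F)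
    push_cast
    split_ifs <;> ring

lemma isHypersimplexPair : IsHypersimplexPair n (sizeClass n) (hypersimplexClass n) :=
  ⟨hypersimplexClass_zero, hypersimplexClass_last, hypersimplexClass_mul_sizeClass,
    sizeClass_succ_eq⟩

open Classical in
lemma prod_sizeClass_eq (K : Finset ℕ) : ∏ k ∈ K, sizeClass n k
    = ∑ c ∈ Finset.univ.filter (fun c : Finset (ProperSubset n) => IsCone c ∧ coneSizes c = K),
      coneClass c := by
  induction K using Finset.induction_on with
  | empty =>
    have : (Finset.univ.filter fun c : Finset (ProperSubset n) => IsCone c ∧ coneSizes c = ∅)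
        = {∅} := by
      ext c
      simp only [Finset.mem_filter, Finset.mem_univ, true_and, Finset.mem_singleton, coneSizes,
        Finset.image_eq_empty]
      exact ⟨fun h => h.2, fun h => ⟨by simp [h, IsCone], h⟩⟩
    rw [this, Finset.prod_empty, Finset.sum_singleton, coneClass, Finset.prod_empty]
  | insert k K hk ih =>
    rw [Finset.prod_insert hk, ih, sizeClass, ← Finset.sum_filter, Finset.sum_mul_sum,
      ← Finset.sum_product']
    have hnot : ∀ {F : ProperSubset n} {c : Finset (ProperSubset n)}, F.1.card = k →
        coneSizes c = K → ∀ G ∈ c, G.1.card ≠ k := by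
      rintro F c - rfl G hG rfl
      exact hk (Finset.mem_image_of_mem _ hG)
    have hsplit : ∀ {F : ProperSubset n} {c : Finset (ProperSubset n)}, F.1.card = k →
        coneSizes c = K → (insert F c).filter (fun G => G.1.card = k) = {F} ∧
          (insert F c).filter (fun G => ¬ G.1.card = k) = c := by
      intro F c hF hc
      rw [Finset.filter_insert, if_pos hF, Finset.filter_insert, if_neg (not_not.2 hF),
        Finset.filter_false_of_mem (hnot hF hc), Finset.filter_true_of_mem (hnot hF hc)]
      simp
    rw [← Finset.sum_filter_add_sum_filter_not _
      (fun p : ProperSubset n × Finset (ProperSubset n) => ∀ G ∈ p.2, p.1.1 ⊆ G.1 ∨ G.1 ⊆ p.1.1)]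
    rw [Finset.sum_eq_zero (s := Finset.filter (fun p => ¬ _) _) fun p hp =>
      divisorClass_mul_coneClass_eq_zero (Finset.mem_filter.1 hp).2, add_zero]
    refine Finset.sum_nbij (fun p => insert p.1 p.2) ?_ ?_ ?_ ?_
    · rintro ⟨F, c⟩ hp
      simp only [Finset.mem_filter, Finset.mem_product, Finset.mem_univ, true_and] at hp ⊢
      obtain ⟨⟨hF, hc, hK⟩, hcomp⟩ := hp
      exact ⟨hc.insert hcomp, by rw [coneSizes, Finset.image_insert, hF, ← hK, coneSizes]⟩
    · rintro ⟨F, c⟩ hp ⟨G, d⟩ hq h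
      simp only [Finset.coe_filter, Set.mem_ofPred_eq, Finset.mem_filter, Finset.mem_product,
        Finset.mem_univ, true_and] at hp hq h
      obtain ⟨h1, h2⟩ := hsplit hp.1.1 hp.1.2.2
      obtain ⟨h3, h4⟩ := hsplit hq.1.1 hq.1.2.2
      rw [h] at h1 h2
      rw [Prod.mk.injEq]
      exact ⟨Finset.singleton_injective (h1.symm.trans h3), h2.symm.trans h4⟩
    · intro c hc
      simp only [Finset.coe_filter, Set.mem_ofPred_eq, Finset.mem_univ, true_and] at hc
      obtain ⟨hc, hK⟩ := hc
      have hkc : k ∈ coneSizes c := hK ▸ Finset.mem_insert_self k K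
      obtain ⟨F, hF, rfl⟩ := Finset.mem_image.1 hkc
      refine ⟨(F, c.erase F), ?_, Finset.insert_erase hF⟩
      simp only [Finset.coe_filter, Set.mem_ofPred_eq, Finset.mem_filter, Finset.mem_product,
        Finset.mem_univ, true_and]
      refine ⟨⟨hc.subset (Finset.erase_subset _ _), ?_⟩,
        fun G hG => hc F hF G (Finset.mem_of_mem_erase hG)⟩
      rw [← Finset.erase_insert hk, ← hK, coneSizes, coneSizes]
      ext j
      simp only [Finset.mem_image, Finset.mem_erase]
      constructor
      · rintro ⟨G, ⟨hGF, hG⟩, rfl⟩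
        exact ⟨fun h => hGF (hc.card_injOn hG hF h), G, hG, rfl⟩
      · rintro ⟨hj, G, hG, rfl⟩
        exact ⟨G, ⟨fun h => hj (by rw [h]), hG⟩, rfl⟩
    · rintro ⟨F, c⟩ hp
      simp only [Finset.mem_filter, Finset.mem_product, Finset.mem_univ, true_and] at hp
      exact divisorClass_mul_coneClass fun h => hnot hp.1.1 hp.1.2.2 F h hp.1.1

/-! ### Rank functions -/

section RankFunction

variable {α : Type*} [DecidableEq α] {ρ ρ' : Finset α → ℕ}

/-- The axioms of the rank function of a matroid. -/
structure IsRankFunction (ρ : Finset α → ℕ) : Prop where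
  empty : ρ ∅ = 0
  mono : ∀ {S T : Finset α}, S ⊆ T → ρ S ≤ ρ T
  insert_le : ∀ (a : α) (S : Finset α), ρ (insert a S) ≤ ρ S + 1
  submodular : ∀ S T : Finset α, ρ (S ∪ T) + ρ (S ∩ T) ≤ ρ S + ρ T

/-- The flats of a rank function. -/
def IsRankFlat (ρ : Finset α → ℕ) (S : Finset α) : Prop :=
  ∀ a ∉ S, ρ S < ρ (insert a S)

/-- The closure operator of a rank function. -/
def rankClosure [Fintype α] (ρ : Finset α → ℕ) (S : Finset α) : Finset α :=
  Finset.univ.filter fun a => ρ (insert a S) = ρ S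

lemma isRankFlat_univ [Fintype α] (ρ : Finset α → ℕ) : IsRankFlat ρ Finset.univ :=
  fun a ha => absurd (Finset.mem_univ a) ha

lemma isRankFlat_empty (h0 : ρ ∅ = 0) (hl : ∀ a, 0 < ρ {a}) : IsRankFlat ρ ∅ :=
  fun a _ => by simpa [h0] using hl a

namespace IsRankFunction

lemma insert_add_le (h : IsRankFunction ρ) {S T : Finset α} (hST : S ⊆ T) (a : α) :
    ρ (insert a T) + ρ S ≤ ρ T + ρ (insert a S) := by
  have h1 := h.submodular (insert a S) T
  have h2 : insert a S ∪ T = insert a T := by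
    rw [Finset.insert_union, Finset.union_eq_right.2 hST]
  have h3 : ρ S ≤ ρ (insert a S ∩ T) :=
    h.mono (Finset.subset_inter (Finset.subset_insert a S) hST)
  rw [h2] at h1
  omega

lemma insert_eq (h : IsRankFunction ρ) {S : Finset α} (hS : IsRankFlat ρ S) {a : α}
    (ha : a ∉ S) : ρ (insert a S) = ρ S + 1 :=
  le_antisymm (h.insert_le a S) (hS a ha)

lemma lt_of_ssubset (h : IsRankFunction ρ) {S T : Finset α} (hS : IsRankFlat ρ S)
    (hST : S ⊂ T) : ρ S < ρ T := by
  obtain ⟨a, haT, haS⟩ := Finset.exists_of_ssubset hST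
  exact (hS a haS).trans_le (h.mono (Finset.insert_subset haT hST.1))

lemma eq_of_subset (h : IsRankFunction ρ) {S T : Finset α} (hS : IsRankFlat ρ S)
    (hST : S ⊆ T) (hle : ρ T ≤ ρ S) : S = T := by
  by_contra hne
  exact absurd (h.lt_of_ssubset hS (Finset.ssubset_iff_subset_ne.2 ⟨hST, hne⟩)) (not_lt.2 hle)

lemma add_card_le (h : IsRankFunction ρ) {S T : Finset α} (hST : S ⊆ T) :
    ρ T + S.card ≤ ρ S + T.card := by
  obtain ⟨U, rfl⟩ : ∃ U, T = U ∪ S := ⟨T, (Finset.union_eq_left.2 hST).symm⟩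
  clear hST
  induction U using Finset.induction_on with
  | empty => simp
  | insert a U ha ih =>
    rw [Finset.insert_union]
    by_cases haU : a ∈ U ∪ S
    · rwa [Finset.insert_eq_of_mem haU]
    · rw [Finset.card_insert_of_notMem haU]
      have := h.insert_le a (U ∪ S)
      omega

lemma le_card (h : IsRankFunction ρ) (S : Finset α) : ρ S ≤ S.card := by
  simpa [h.empty] using h.add_card_le (Finset.empty_subset S)

variable [Fintype α]

lemma subset_rankClosure (S : Finset α) : S ⊆ rankClosure ρ S := fun a ha => by
  simp [rankClosure, Finset.insert_eq_of_mem ha]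

lemma rank_rankClosure (h : IsRankFunction ρ) (S : Finset α) : ρ (rankClosure ρ S) = ρ S := by
  have key : ∀ T, T ⊆ rankClosure ρ S → ρ (T ∪ S) ≤ ρ S := by
    intro T
    induction T using Finset.induction_on with
    | empty => simp
    | insert a T ha ih =>
      intro hT
      have h1 := h.insert_add_le (Finset.subset_union_right : S ⊆ T ∪ S) a
      have h2 : ρ (insert a S) = ρ S := (Finset.mem_filter.1 (hT (Finset.mem_insert_self a T))).2
      have h3 := ih ((Finset.subset_insert a T).trans hT)
      rw [Finset.insert_union]
      omega
  refine le_antisymm ?_ (h.mono (subset_rankClosure S))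
  have := key _ subset_rfl
  rwa [Finset.union_eq_left.2 (subset_rankClosure S)] at this

lemma isRankFlat_rankClosure (h : IsRankFunction ρ) (S : Finset α) :
    IsRankFlat ρ (rankClosure ρ S) := by
  intro a ha
  rw [h.rank_rankClosure]
  have h1 : ρ S ≤ ρ (insert a S) := h.mono (Finset.subset_insert a S)
  have h2 : ρ (insert a S) ≠ ρ S := fun e => ha (by simpa [rankClosure] using e)
  have h3 : ρ (insert a S) ≤ ρ (insert a (rankClosure ρ S)) :=
    h.mono (Finset.insert_subset_insert a (subset_rankClosure S))
  omega

lemma rankClosure_subset (h : IsRankFunction ρ) {S F : Finset α} (hF : IsRankFlat ρ F)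
    (hSF : S ⊆ F) : rankClosure ρ S ⊆ F := by
  intro a ha
  by_contra haF
  have h1 := h.insert_add_le hSF a
  have h2 : ρ (insert a S) = ρ S := (Finset.mem_filter.1 ha).2
  have h3 := hF a haF
  omega

lemma rankClosure_mono (h : IsRankFunction ρ) {S T : Finset α} (hST : S ⊆ T) :
    rankClosure ρ S ⊆ rankClosure ρ T :=
  h.rankClosure_subset (h.isRankFlat_rankClosure T) (hST.trans (subset_rankClosure T))

lemma rankClosure_eq (h : IsRankFunction ρ) {S F : Finset α} (hF : IsRankFlat ρ F)
    (hSF : S ⊆ F) (hle : ρ F ≤ ρ S) : rankClosure ρ S = F :=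
  h.eq_of_subset (h.isRankFlat_rankClosure S) (h.rankClosure_subset hF hSF)
    (by rwa [h.rank_rankClosure])

end IsRankFunction

/-- `ρ'` is an elementary quotient of `ρ`: it arises by lowering the rank by one on an upward
closed family of sets. -/
structure IsElementaryQuotient (ρ ρ' : Finset α → ℕ) : Prop where
  le : ∀ S, ρ' S ≤ ρ S
  le_succ : ∀ S, ρ S ≤ ρ' S + 1
  mono : ∀ {S T : Finset α}, S ⊆ T → ρ S + ρ' T ≤ ρ T + ρ' S

lemma IsElementaryQuotient.isRankFlat (hq : IsElementaryQuotient ρ ρ') {S : Finset α}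
    (hS : IsRankFlat ρ' S) : IsRankFlat ρ S := by
  intro a ha
  have h1 := hS a ha
  have h2 := hq.mono (Finset.subset_insert a S)
  omega

/-- The sets on which the rank drops form a modular cut: if it drops on a flat `T` and on
`X ∪ {b}`, but not on the subset `X` of `T`, then `b` lies in `T`. -/
lemma IsElementaryQuotient.mem_of_drop (hq : IsElementaryQuotient ρ ρ') (h : IsRankFunction ρ)
    (h' : IsRankFunction ρ') {X T : Finset α} (hXT : X ⊆ T) (hT : IsRankFlat ρ T) {b : α}
    (hX0 : ρ X = ρ' X) (hT1 : ρ T = ρ' T + 1) (hb : ρ (insert b X) = ρ' (insert b X) + 1) :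
    b ∈ T := by
  by_contra hbT
  have h1 := h'.insert_add_le hXT b
  have h2 := h.insert_eq hT hbT
  have h3 := h.insert_le b X
  have h4 := hq.le_succ (insert b T)
  omega

/-- The rank function of the `i`-th Higgs lift. -/
def higgsLift (ρ : Finset α → ℕ) (i : ℕ) (S : Finset α) : ℕ :=
  min S.card (ρ S + i)

lemma isRankFunction_higgsLift (h : IsRankFunction ρ) (i : ℕ) :
    IsRankFunction (higgsLift ρ i) where
  empty := by simp [higgsLift]
  mono {S T} hST := by
    have h1 := h.mono hST
    have h2 := Finset.card_le_card hST
    simp only [higgsLift]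
    omega
  insert_le a S := by
    have h1 := h.insert_le a S
    have h2 := Finset.card_insert_le a S
    simp only [higgsLift]
    omega
  submodular S T := by
    have h1 := h.submodular S T
    have h2 := Finset.card_union_add_card_inter S T
    have h3 := h.add_card_le (Finset.inter_subset_left : S ∩ T ⊆ S)
    have h4 := h.add_card_le (Finset.inter_subset_right : S ∩ T ⊆ T)
    have h5 := h.add_card_le (Finset.subset_union_left : S ⊆ S ∪ T)
    have h6 := h.add_card_le (Finset.subset_union_right : T ⊆ S ∪ T)
    simp only [higgsLift]
    omega

lemma isElementaryQuotient_higgsLift (h : IsRankFunction ρ) (i : ℕ) :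
    IsElementaryQuotient (higgsLift ρ (i + 1)) (higgsLift ρ i) where
  le S := by simp only [higgsLift]; omega
  le_succ S := by simp only [higgsLift]; omega
  mono {S T} hST := by
    have h1 := h.add_card_le hST
    simp only [higgsLift]
    omega

end RankFunction

/-! ### Complete flags of flats and the class of a matroid -/

section Flags

variable {ρ ρ' : Finset (Fin (n + 1)) → ℕ} {c : Finset (ProperSubset n)}

/-- A chain of nonempty proper flats of `ρ` whose length is one less than the rank; when `ρ` has
no loops, this is a complete flag of flats without its two trivial members. -/
def IsRankFlag (ρ : Finset (Fin (n + 1)) → ℕ) (c : Finset (ProperSubset n)) : Prop :=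
  IsCone c ∧ c.card + 1 = ρ Finset.univ ∧ ∀ F ∈ c, IsRankFlat ρ F.1

lemma IsRankFunction.pos_of_nonempty (h : IsRankFunction ρ) (hl : ∀ a, 0 < ρ {a})
    {S : Finset (Fin (n + 1))} (hS : S.Nonempty) : 0 < ρ S := by
  obtain ⟨a, ha⟩ := hS
  exact (hl a).trans_le (h.mono (Finset.singleton_subset_iff.2 ha))

lemma IsRankFunction.lt_univ (h : IsRankFunction ρ) {F : ProperSubset n}
    (hF : IsRankFlat ρ F.1) : ρ F.1 < ρ Finset.univ :=
  h.lt_of_ssubset hF (Finset.ssubset_univ_iff.2 F.2.2)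

lemma IsCone.rank_injOn (hc : IsCone c) (h : IsRankFunction ρ)
    (hF : ∀ F ∈ c, IsRankFlat ρ F.1) : Set.InjOn (fun F : ProperSubset n => ρ F.1) c := by
  intro F hFc G hGc hFG
  rcases hc F hFc G hGc with h' | h'
  · exact Subtype.ext (h.eq_of_subset (hF F hFc) h' hFG.ge)
  · exact Subtype.ext (h.eq_of_subset (hF G hGc) h' hFG.le).symm

/-- A complete flag contains a flat of each rank. -/
lemma IsRankFlag.exists_rank_eq (hc : IsRankFlag ρ c) (h : IsRankFunction ρ)
    (hl : ∀ a, 0 < ρ {a}) {k : ℕ} (hk1 : 1 ≤ k) (hk : k < ρ Finset.univ) :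
    ∃ F ∈ c, ρ F.1 = k := by
  obtain ⟨hcone, hcard, hflat⟩ := hc
  have himg : c.image (fun F => ρ F.1) = Finset.Icc 1 c.card := by
    refine Finset.eq_of_subset_of_card_le (fun k hk => ?_) ?_
    · obtain ⟨F, hF, rfl⟩ := Finset.mem_image.1 hk
      have h1 := h.pos_of_nonempty hl F.2.1
      have h2 := h.lt_univ (hflat F hF)
      rw [Finset.mem_Icc]
      omega
    · rw [Finset.card_image_of_injOn (hcone.rank_injOn h hflat), Nat.card_Icc]
      omega
  have : k ∈ c.image (fun F => ρ F.1) := by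
    rw [himg, Finset.mem_Icc]
    omega
  exact Finset.mem_image.1 this

/-- The ranks of consecutive members of a complete flag, with `∅` and the ground set included,
differ by one. -/
lemma IsRankFlag.rank_eq_succ (hc : IsRankFlag ρ c) (h : IsRankFunction ρ)
    (hl : ∀ a, 0 < ρ {a}) {X Y : Finset (Fin (n + 1))} (hX : IsRankFlat ρ X) (hXY : X ⊂ Y)
    (hgap : ∀ F ∈ c, F.1 ⊆ X ∨ Y ⊆ F.1) : ρ Y = ρ X + 1 := by
  have h1 := h.lt_of_ssubset hX hXY
  have h2 := h.mono (Finset.subset_univ Y)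
  by_contra hne
  obtain ⟨F, hF, hFk⟩ := hc.exists_rank_eq h hl (k := ρ X + 1) (by omega) (by omega)
  rcases hgap F hF with h' | h'
  · have := h.mono h'
    omega
  · have := h.mono h'
    omega

lemma IsCone.exists_greatest (hc : IsCone c) :
    ∃ X, (X = ∅ ∨ ∃ F ∈ c, F.1 = X) ∧ ∀ F ∈ c, F.1 ⊆ X := by
  rcases c.eq_empty_or_nonempty with rfl | hne
  · exact ⟨∅, Or.inl rfl, by simp⟩
  · obtain ⟨F, hF, hmax⟩ := Finset.exists_max_image c (fun F => F.1.card) hne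
    refine ⟨F.1, Or.inr ⟨F, hF, rfl⟩, fun G hG => ?_⟩
    rcases hc G hG F hF with h | h
    · exact h
    · exact (Finset.eq_of_subset_of_card_le h (hmax G hG)).ge

lemma IsCone.exists_least (hc : IsCone c) :
    ∃ Y, (Y = Finset.univ ∨ ∃ F ∈ c, F.1 = Y) ∧ ∀ F ∈ c, Y ⊆ F.1 := by
  rcases c.eq_empty_or_nonempty with rfl | hne
  · exact ⟨Finset.univ, Or.inl rfl, by simp⟩
  · obtain ⟨F, hF, hmin⟩ := Finset.exists_min_image c (fun F => F.1.card) hne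
    refine ⟨F.1, Or.inr ⟨F, hF, rfl⟩, fun G hG => ?_⟩
    rcases hc G hG F hF with h | h
    · exact (Finset.eq_of_subset_of_card_le h (hmin G hG)).ge
    · exact h

/-- The place in a chain where a monotone property of sets begins to hold. -/
lemma IsCone.exists_gap (hc : IsCone c) (p : Finset (Fin (n + 1)) → Prop)
    (hp : ∀ {S T}, S ⊆ T → p S → p T) (h0 : ¬ p ∅) (h1 : p Finset.univ) :
    ∃ X Y, (X = ∅ ∨ ∃ F ∈ c, F.1 = X) ∧ (Y = Finset.univ ∨ ∃ F ∈ c, F.1 = Y) ∧ X ⊂ Y ∧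
      ¬ p X ∧ p Y ∧ ∀ F ∈ c, (F.1 ⊆ X ∧ ¬ p F.1) ∨ (Y ⊆ F.1 ∧ p F.1) := by
  classical
  obtain ⟨X, hX, hXmax⟩ :=
    (hc.subset (Finset.filter_subset (fun F => ¬ p F.1) c)).exists_greatest
  obtain ⟨Y, hY, hYmin⟩ :=
    (hc.subset (Finset.filter_subset (fun F => p F.1) c)).exists_least
  have hpX : ¬ p X := by
    rcases hX with rfl | ⟨F, hF, rfl⟩
    · exact h0
    · exact (Finset.mem_filter.1 hF).2
  have hpY : p Y := by
    rcases hY with rfl | ⟨F, hF, rfl⟩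
    · exact h1
    · exact (Finset.mem_filter.1 hF).2
  have hX' : X = ∅ ∨ ∃ F ∈ c, F.1 = X :=
    hX.imp_right fun ⟨F, hF, h⟩ => ⟨F, (Finset.mem_filter.1 hF).1, h⟩
  have hY' : Y = Finset.univ ∨ ∃ F ∈ c, F.1 = Y :=
    hY.imp_right fun ⟨F, hF, h⟩ => ⟨F, (Finset.mem_filter.1 hF).1, h⟩
  refine ⟨X, Y, hX', hY', Finset.ssubset_iff_subset_ne.2 ⟨?_, fun e => hpX (e ▸ hpY)⟩, hpX, hpY,
    fun F hF => ?_⟩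
  · rcases hX' with rfl | ⟨F, hF, rfl⟩
    · exact Finset.empty_subset _
    rcases hY' with rfl | ⟨G, hG, rfl⟩
    · exact Finset.subset_univ _
    rcases hc F hF G hG with h | h
    · exact h
    · exact absurd (hp h hpY) hpX
  · by_cases hpF : p F.1
    · exact Or.inr ⟨hYmin F (Finset.mem_filter.2 ⟨hF, hpF⟩), hpF⟩
    · exact Or.inl ⟨hXmax F (Finset.mem_filter.2 ⟨hF, hpF⟩), hpF⟩

/-- The divisor class that cuts the class of an elementary quotient `ρ'` out of the class of `ρ`.
It is represented by the function `S ↦ ρ' S - ρ S`, made to vanish on the ground set by adding the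
linear function `S ↦ |S ∩ {a}|`. -/
def quotientDivisor (ρ ρ' : Finset (Fin (n + 1)) → ℕ) (a : Fin (n + 1)) : Chow n :=
  ∑ S : ProperSubset n,
    ((if a ∈ S.1 then 1 else 0) - ((ρ S.1 : ℚ) - (ρ' S.1 : ℚ))) • divisorClass S

lemma quotientDivisor_eq (ρ ρ' : Finset (Fin (n + 1)) → ℕ) (a b : Fin (n + 1)) :
    quotientDivisor ρ ρ' a = quotientDivisor ρ ρ' b := by
  have h := sum_divisorClass_mem a b
  simp only [quotientDivisor, sub_smul (ite _ _ _), Finset.sum_sub_distrib, ite_smul, one_smul,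
    zero_smul, h]

/-- The flats strictly between flats `X ⊂ Y` with `ρ Y = ρ X + 2` partition `Y \ X`. -/
lemma exists_unique_flat_between (h : IsRankFunction ρ) {X Y : Finset (Fin (n + 1))}
    (hX : IsRankFlat ρ X) (hY : IsRankFlat ρ Y) (hXY : X ⊂ Y) (hrk : ρ Y = ρ X + 2)
    {b : Fin (n + 1)} (hbY : b ∈ Y) (hbX : b ∉ X) :
    ∃ T : ProperSubset n, IsRankFlat ρ T.1 ∧ X ⊂ T.1 ∧ T.1 ⊂ Y ∧ insert b X ⊆ T.1 ∧
      ∀ S : ProperSubset n, IsRankFlat ρ S.1 → X ⊂ S.1 → S.1 ⊂ Y → b ∈ S.1 → S = T := by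
  have hflat := h.isRankFlat_rankClosure (insert b X)
  have hrank : ρ (rankClosure ρ (insert b X)) = ρ X + 1 := by
    rw [h.rank_rankClosure, h.insert_eq hX hbX]
  have hsub : insert b X ⊆ rankClosure ρ (insert b X) := IsRankFunction.subset_rankClosure _
  have hTY : rankClosure ρ (insert b X) ⊂ Y := by
    refine Finset.ssubset_iff_subset_ne.2
      ⟨h.rankClosure_subset hY (Finset.insert_subset hbY hXY.1), fun e => ?_⟩
    rw [e] at hrank
    omega
  refine ⟨⟨rankClosure ρ (insert b X), ⟨b, hsub (Finset.mem_insert_self b X)⟩, fun e => ?_⟩,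
    hflat, ?_, hTY, hsub, fun S hS hXS hSY hbS => Subtype.ext ?_⟩
  · rw [e] at hTY
    exact hTY.2 (Finset.subset_univ Y)
  · exact (Finset.ssubset_insert hbX).trans_subset hsub
  · have := h.lt_of_ssubset hS hSY
    refine (h.rankClosure_eq hS (Finset.insert_subset hbS hXS.1) ?_).symm
    rw [h.insert_eq hX hbX]
    omega

open Classical in
/-- Multiplication with the divisor of an elementary quotient turns the functional that counts
complete flags of `ρ` into the one that counts complete flags of `ρ'`. In a cone `c` of
codimension one, let `X ⊂ Y` be the consecutive members between which the drop of the rank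
begins. With `a` chosen in `Y \ X`, only flats strictly between `X` and `Y` contribute: there is
one such flat that contains `a`, and it is cancelled by the one on which the rank drops, unless
there is none of the latter kind, that is, unless `X` is a flat of `ρ'`. -/
lemma map_quotientDivisor_mul_coneClass (h : IsRankFunction ρ) (h' : IsRankFunction ρ')
    (hl : ∀ a, 0 < ρ' {a}) (hq : IsElementaryQuotient ρ ρ')
    (huniv : ρ Finset.univ = ρ' Finset.univ + 1) (φ : Chow n →ₗ[ℚ] ℚ)
    (hφ : ∀ c : Finset (ProperSubset n), IsCone c →
      φ (coneClass c) = if IsRankFlag ρ c then 1 else 0)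
    (a₀ : Fin (n + 1)) {c : Finset (ProperSubset n)} (hc : IsCone c) :
    φ (quotientDivisor ρ ρ' a₀ * coneClass c) = if IsRankFlag ρ' c then 1 else 0 := by
  have hl' : ∀ a, 0 < ρ {a} := fun a => (hl a).trans_le (hq.le _)
  have hdrop : ∀ S, ¬ ρ S = ρ' S + 1 → ρ S = ρ' S := fun S hS => by
    have := hq.le S
    have := hq.le_succ S
    omega
  obtain ⟨X, Y, hX, hY, hXY, hpX, hpY, hgap⟩ := hc.exists_gap (fun S => ρ S = ρ' S + 1)
    (fun {S T} hST hS => by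
      have := hq.mono hST
      have := hq.le_succ T
      omega) (by simp [h.empty]) huniv
  have hXcomp : ∀ S : ProperSubset n, (∀ G ∈ c, S.1 ⊆ G.1 ∨ G.1 ⊆ S.1) →
      S.1 ⊆ X ∨ X ⊆ S.1 := fun S hS => by
    rcases hX with rfl | ⟨F, hF, rfl⟩
    · exact Or.inr (Finset.empty_subset _)
    · exact hS F hF
  have hYcomp : ∀ S : ProperSubset n, (∀ G ∈ c, S.1 ⊆ G.1 ∨ G.1 ⊆ S.1) →
      S.1 ⊆ Y ∨ Y ⊆ S.1 := fun S hS => by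
    rcases hY with rfl | ⟨F, hF, rfl⟩
    · exact Or.inl (Finset.subset_univ _)
    · exact hS F hF
  have hXflat : ∀ μ : Finset (Fin (n + 1)) → ℕ, μ ∅ = 0 → (∀ a, 0 < μ {a}) →
      (∀ F ∈ c, IsRankFlat μ F.1) → IsRankFlat μ X := fun μ h0 hμ hF => by
    rcases hX with rfl | ⟨F, hFc, rfl⟩
    · exact isRankFlat_empty h0 hμ
    · exact hF F hFc
  have hYflat : (∀ F ∈ c, IsRankFlat ρ F.1) → IsRankFlat ρ Y := fun hF => by
    rcases hY with rfl | ⟨F, hFc, rfl⟩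
    · exact isRankFlat_univ ρ
    · exact hF F hFc
  obtain ⟨a, haY, haX⟩ := Finset.exists_of_ssubset hXY
  set P : ProperSubset n → Prop := fun S => IsRankFlag ρ (insert S c) ∧ X ⊂ S.1 ∧ S.1 ⊂ Y
    with hP
  have hnotc : ∀ S : ProperSubset n, X ⊂ S.1 → S.1 ⊂ Y → S ∉ c := fun S hXS hSY hS => by
    rcases hgap S hS with ⟨h1, -⟩ | ⟨h1, -⟩
    · exact hXS.2 h1
    · exact hSY.2 h1
  have hterm : ∀ S : ProperSubset n,
      ((if a ∈ S.1 then 1 else 0) - ((ρ S.1 : ℚ) - (ρ' S.1 : ℚ))) *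
        φ (divisorClass S * coneClass c)
      = (if P S ∧ a ∈ S.1 then 1 else 0) - if P S ∧ ρ S.1 = ρ' S.1 + 1 then 1 else 0 := by
    intro S
    have hcoef : (ρ S.1 : ℚ) - (ρ' S.1 : ℚ) = if ρ S.1 = ρ' S.1 + 1 then 1 else 0 := by
      split_ifs with hS
      · rw [hS]; push_cast; ring
      · rw [hdrop _ hS, sub_self]
    rw [hcoef]
    have hlow : S.1 ⊆ X → ¬ a ∈ S.1 ∧ ¬ ρ S.1 = ρ' S.1 + 1 := fun hSX =>
      ⟨fun ha => haX (hSX ha), fun hS => by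
        have := hq.mono hSX
        have := hdrop _ hpX
        omega⟩
    have hhigh : Y ⊆ S.1 → a ∈ S.1 ∧ ρ S.1 = ρ' S.1 + 1 := fun hYS =>
      ⟨hYS haY, by
        have := hq.mono hYS
        have := hq.le_succ S.1
        omega⟩
    by_cases hPS : P S
    · have hS := hnotc S hPS.2.1 hPS.2.2
      rw [divisorClass_mul_coneClass hS, hφ _ hPS.1.1, if_pos hPS.1]
      simp [hPS]
    · have hout : S.1 ⊆ X ∨ Y ⊆ S.1 ∨ φ (divisorClass S * coneClass c) = 0 := by
        by_cases hS : S ∈ c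
        · rcases hgap S hS with ⟨h1, -⟩ | ⟨h1, -⟩
          · exact Or.inl h1
          · exact Or.inr (Or.inl h1)
        by_cases hcomp : ∀ G ∈ c, S.1 ⊆ G.1 ∨ G.1 ⊆ S.1
        · by_cases h1 : S.1 ⊆ X
          · exact Or.inl h1
          by_cases h2 : Y ⊆ S.1
          · exact Or.inr (Or.inl h2)
          refine Or.inr (Or.inr ?_)
          rw [divisorClass_mul_coneClass hS, hφ _ (hc.insert hcomp), if_neg]
          exact fun hf => hPS ⟨hf, ⟨(hXcomp S hcomp).resolve_left h1, h1⟩,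
            ⟨(hYcomp S hcomp).resolve_right h2, h2⟩⟩
        · exact Or.inr (Or.inr (by rw [divisorClass_mul_coneClass_eq_zero hcomp, map_zero]))
      rcases hout with h1 | h1 | h1
      · simp [hPS, hlow h1]
      · simp [hPS, hhigh h1]
      · simp [hPS, h1]
  rw [quotientDivisor_eq ρ ρ' a₀ a, quotientDivisor, Finset.sum_mul, map_sum]
  simp only [smul_mul_assoc, map_smul, smul_eq_mul, hterm]
  rw [Finset.sum_sub_distrib]
  by_cases hA : (∀ F ∈ c, IsRankFlat ρ F.1) ∧ c.card + 2 = ρ Finset.univ ∧ ρ Y = ρ X + 2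
  · obtain ⟨hflat, hcard, hrk⟩ := hA
    have hXf := hXflat ρ h.empty hl' hflat
    have hYf := hYflat hflat
    have hPiff : ∀ S : ProperSubset n, P S ↔ IsRankFlat ρ S.1 ∧ X ⊂ S.1 ∧ S.1 ⊂ Y := by
      intro S
      refine ⟨fun hS => ⟨hS.1.2.2 S (Finset.mem_insert_self _ _), hS.2⟩, fun ⟨hS, hXS, hSY⟩ =>
        ⟨⟨hc.insert fun G hG => ?_, ?_, fun F hF => ?_⟩, hXS, hSY⟩⟩
      · rcases hgap G hG with ⟨h1, -⟩ | ⟨h1, -⟩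
        · exact Or.inr (h1.trans hXS.1)
        · exact Or.inl (hSY.1.trans h1)
      · rw [Finset.card_insert_of_notMem (hnotc S hXS hSY)]
        omega
      · rcases Finset.mem_insert.1 hF with rfl | hF
        · exact hS
        · exact hflat F hF
    obtain ⟨A, hAf, hXA, hAY, haA, hAu⟩ :=
      exists_unique_flat_between h hXf hYf hXY hrk haY haX
    have hAiff : ∀ S : ProperSubset n, (P S ∧ a ∈ S.1) ↔ S = A := fun S =>
      ⟨fun ⟨hS, ha⟩ => by
        rw [hPiff] at hS
        exact hAu S hS.1 hS.2.1 hS.2.2 ha,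
      fun hS => by
        subst hS
        exact ⟨(hPiff S).2 ⟨hAf, hXA, hAY⟩, haA (Finset.mem_insert_self a X)⟩⟩
    simp only [hAiff, Finset.sum_ite_eq', Finset.mem_univ, if_true]
    by_cases hX' : IsRankFlat ρ' X
    · have hflag : IsRankFlag ρ' c := by
        refine ⟨hc, by omega, fun F hF b hb => ?_⟩
        have h1 := hflat F hF b hb
        have h2 := hq.le_succ (insert b F.1)
        have h3 := hq.le (insert b F.1)
        rcases hgap F hF with ⟨hFX, hpF⟩ | ⟨hYF, hpF⟩
        · have h4 := hdrop _ hpF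
          have h6 := hdrop _ hpX
          by_cases hbX : b ∈ X
          · have h5 := hq.mono (Finset.insert_subset hbX hFX)
            omega
          · have h5 := hX' b hbX
            have h7 := h.insert_eq hXf hbX
            have h8 := hq.mono (Finset.insert_subset_insert b hFX)
            omega
        · omega
      have hnone : ∀ S : ProperSubset n, ¬ (P S ∧ ρ S.1 = ρ' S.1 + 1) := by
        rintro S ⟨hS, hpS⟩
        rw [hPiff] at hS
        obtain ⟨b, hbS, hbX⟩ := Finset.exists_of_ssubset hS.2.1
        have h1 := hX' b hbX
        have h2 := h'.mono (Finset.insert_subset hbS hS.2.1.1)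
        have h3 := h.lt_of_ssubset hS.1 hS.2.2
        have h4 := hdrop _ hpX
        omega
      simp [hnone, hflag]
    · have hflag : ¬ IsRankFlag ρ' c := fun hf => hX' (hXflat ρ' h'.empty hl hf.2.2)
      rw [IsRankFlat] at hX'
      push Not at hX'
      obtain ⟨b, hbX, hb⟩ := hX'
      have hXeq := hdrop _ hpX
      have hpb : ρ (insert b X) = ρ' (insert b X) + 1 := by
        have h1 := h.insert_eq hXf hbX
        have h2 := hq.le_succ (insert b X)
        omega
      have hbY : b ∈ Y := hq.mem_of_drop h h' hXY.1 hYf hXeq hpY hpb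
      obtain ⟨B, hBf, hXB, hBY, hbB, hBu⟩ :=
        exists_unique_flat_between h hXf hYf hXY hrk hbY hbX
      have hBiff : ∀ S : ProperSubset n, (P S ∧ ρ S.1 = ρ' S.1 + 1) ↔ S = B := fun S =>
        ⟨fun ⟨hS, hpS⟩ => by
          rw [hPiff] at hS
          exact hBu S hS.1 hS.2.1 hS.2.2 (hq.mem_of_drop h h' hS.2.1.1 hS.1 hXeq hpS hpb),
        fun hS => by
          subst hS
          refine ⟨(hPiff S).2 ⟨hBf, hXB, hBY⟩, ?_⟩
          have h1 := hq.mono hbB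
          have h2 := hq.le_succ S.1
          omega⟩
      simp [hBiff, hflag]
  · have hPn : ∀ S, ¬ P S := by
      rintro S ⟨hf, hXS, hSY⟩
      have hflat : ∀ F ∈ c, IsRankFlat ρ F.1 := fun F hF =>
        hf.2.2 F (Finset.mem_insert_of_mem hF)
      have hS : IsRankFlat ρ S.1 := hf.2.2 S (Finset.mem_insert_self _ _)
      have hcard := hf.2.1
      rw [Finset.card_insert_of_notMem (hnotc S hXS hSY)] at hcard
      have h1 := hf.rank_eq_succ h hl' (hXflat ρ h.empty hl' hflat) hXS fun F hF => by
        rcases Finset.mem_insert.1 hF with rfl | hF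
        · exact Or.inr subset_rfl
        · rcases hgap F hF with ⟨h1, -⟩ | ⟨h1, -⟩
          · exact Or.inl h1
          · exact Or.inr (hSY.1.trans h1)
      have h2 := hf.rank_eq_succ h hl' hS hSY fun F hF => by
        rcases Finset.mem_insert.1 hF with rfl | hF
        · exact Or.inl subset_rfl
        · rcases hgap F hF with ⟨h1, -⟩ | ⟨h1, -⟩
          · exact Or.inl (h1.trans hXS.1)
          · exact Or.inr h1
      exact hA ⟨hflat, by omega, by omega⟩
    have hfn : ¬ IsRankFlag ρ' c := by
      intro hf
      have h1 := hf.rank_eq_succ h' hl (hXflat ρ' h'.empty hl hf.2.2) hXY fun F hF =>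
        (hgap F hF).imp And.left And.left
      have h2 := hdrop _ hpX
      have h3 := hf.2.1
      exact hA ⟨fun F hF => hq.isRankFlat (hf.2.2 F hF), by omega, by omega⟩
    simp [hPn, hfn]

open Classical in
/-- The class of a matroid without loops: the product of the divisors of the elementary quotients
between consecutive Higgs lifts, which lead from the free matroid to the given one. -/
lemma exists_forall_degreeMap_eq (h : IsRankFunction ρ) (hl : ∀ a, 0 < ρ {a}) :
    ∃ ξ : Chow n, ∀ c : Finset (ProperSubset n), IsCone c →
      degreeMap n (ξ * coneClass c) = if IsRankFlag ρ c then 1 else 0 := by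
  have huniv : ρ Finset.univ ≤ n + 1 := by simpa using h.le_card Finset.univ
  have hfree : ∀ S, higgsLift ρ (n + 1 - ρ Finset.univ) S = S.card := fun S => by
    have h1 := h.add_card_le (Finset.subset_univ S)
    rw [Finset.card_univ, Fintype.card_fin] at h1
    rw [higgsLift]
    omega
  have hstep : ∀ i, i ≤ n + 1 - ρ Finset.univ → ∃ ξ : Chow n,
      ∀ c : Finset (ProperSubset n), IsCone c →
        degreeMap n (ξ * coneClass c) = if IsRankFlag (higgsLift ρ i) c then 1 else 0 := by
    intro i hi
    induction hi using Nat.decreasingInduction with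
    | self =>
      refine ⟨1, fun c hc => ?_⟩
      have hiff : IsRankFlag (higgsLift ρ (n + 1 - ρ Finset.univ)) c ↔ c.card = n := by
        rw [IsRankFlag, hfree, Finset.card_univ, Fintype.card_fin, Nat.add_right_cancel_iff]
        refine ⟨fun hf => hf.2.1, fun hcard => ⟨hc, hcard, fun F _ a ha => ?_⟩⟩
        rw [hfree, hfree, Finset.card_insert_of_notMem ha]
        exact Nat.lt_succ_self _
      rw [one_mul, isDegreeMap_degreeMap n c hc, if_congr hiff rfl rfl]
    | of_succ i hi ih =>
      obtain ⟨ξ, hξ⟩ := ih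
      refine ⟨ξ * quotientDivisor (higgsLift ρ (i + 1)) (higgsLift ρ i) 0, fun c hc => ?_⟩
      have := map_quotientDivisor_mul_coneClass (isRankFunction_higgsLift h (i + 1))
        (isRankFunction_higgsLift h i) (fun a => by have := hl a; simp [higgsLift]; omega)
        (isElementaryQuotient_higgsLift h i)
        (by simp only [higgsLift, Finset.card_univ, Fintype.card_fin]; omega)
        (degreeMap n ∘ₗ LinearMap.mulLeft ℚ ξ) (fun d hd => by simpa using hξ d hd) 0 hc
      simpa [mul_assoc] using this
  have h0 : higgsLift ρ 0 = ρ := funext fun S => by simpa [higgsLift] using h.le_card S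
  simpa only [h0] using hstep 0 (Nat.zero_le _)

end Flags

/-! ### Permutations and complete flags -/

lemma prefixSet_succ (σ : Equiv.Perm (Fin (n + 1))) (p : Fin (n + 1)) :
    prefixSet σ ((p : ℕ) + 1) = insert (σ p) (prefixSet σ p) := by
  ext a
  rw [Finset.mem_insert, mem_prefixSet, mem_prefixSet, Nat.lt_succ_iff_lt_or_eq, or_comm,
    ← Equiv.symm_apply_eq, Fin.ext_iff]

/-- One more than the greatest of the first `k` letters of the word `w`, or `0` for `k = 0`. -/
def growth (w : Fin (n + 1) → ℕ) (k : ℕ) : ℕ :=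
  (Finset.univ.filter fun i : Fin (n + 1) => (i : ℕ) < k).sup fun i => w i + 1

/-- No letter of the word exceeds the preceding ones by more than one, and the first is `0`. -/
def IsRestrictedGrowth (w : Fin (n + 1) → ℕ) : Prop :=
  ∀ p, w p ≤ growth w p

/-- For a word of restricted growth, the indicator function of the positions of its records. -/
def recordSeq (w : Fin (n + 1) → ℕ) : Fin (n + 1) → ℕ :=
  fun p => growth w ((p : ℕ) + 1) - growth w p

lemma growth_zero (w : Fin (n + 1) → ℕ) : growth w 0 = 0 := by
  simp [growth]

lemma growth_succ (w : Fin (n + 1) → ℕ) (p : Fin (n + 1)) :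
    growth w ((p : ℕ) + 1) = max (w p + 1) (growth w p) := by
  have : (Finset.univ.filter fun i : Fin (n + 1) => (i : ℕ) < p + 1)
      = insert p (Finset.univ.filter fun i : Fin (n + 1) => (i : ℕ) < p) := by
    ext i
    simp only [Finset.mem_filter, Finset.mem_univ, true_and, Finset.mem_insert, Fin.ext_iff]
    omega
  rw [growth, this, Finset.sup_insert]
  rfl

lemma growth_comp (w : Fin (n + 1) → ℕ) (σ : Equiv.Perm (Fin (n + 1))) (k : ℕ) :
    growth (w ∘ σ) k = (prefixSet σ k).sup fun a => w a + 1 := by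
  rw [prefixSet_eq_map, Finset.sup_map]
  rfl

section Flags

variable {ρ : Finset (Fin (n + 1)) → ℕ} {c d : Finset (ProperSubset n)}

/-- The member of rank `m` of a complete flag consists of the elements of level less than `m`. -/
lemma IsRankFlag.coneLevel_lt_iff (hc : IsRankFlag ρ c) (h : IsRankFunction ρ)
    (hl : ∀ a, 0 < ρ {a}) {F : ProperSubset n} (hF : F ∈ c) (a : Fin (n + 1)) :
    coneLevel c a < ρ F.1 ↔ a ∈ F.1 := by
  have hinj := hc.1.rank_injOn h hc.2.2
  have hcard : coneLevel c a = ((c.filter fun G => a ∉ G.1).image fun G => ρ G.1).card :=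
    (Finset.card_image_of_injOn
      (hinj.mono (Finset.coe_subset.2 (Finset.filter_subset _ _)))).symm
  have hpos := h.pos_of_nonempty hl F.2.1
  rw [hcard]
  constructor
  · intro hlt
    by_contra ha
    refine absurd (Finset.card_le_card (s := Finset.Icc 1 (ρ F.1)) fun k hk => ?_)
      (not_le.2 (hlt.trans_eq (by simp)))
    rw [Finset.mem_Icc] at hk
    obtain ⟨G, hG, rfl⟩ := hc.exists_rank_eq h hl hk.1 (hk.2.trans_lt (h.lt_univ (hc.2.2 F hF)))
    refine Finset.mem_image_of_mem _ (Finset.mem_filter.2 ⟨hG, fun haG => ha ?_⟩)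
    rcases hc.1 G hG F hF with h' | h'
    · exact h' haG
    · rw [h.eq_of_subset (hc.2.2 F hF) h' hk.2]
      exact haG
  · intro ha
    refine (Finset.card_le_card (t := Finset.Icc 1 (ρ F.1 - 1)) fun k hk => ?_).trans_lt
      (by rw [Nat.card_Icc]; omega)
    obtain ⟨G, hG, rfl⟩ := Finset.mem_image.1 hk
    obtain ⟨hG, haG⟩ := Finset.mem_filter.1 hG
    have h1 := h.pos_of_nonempty hl G.2.1
    have h2 : ρ G.1 < ρ F.1 := by
      rcases hc.1 G hG F hF with h' | h'
      · exact h.lt_of_ssubset (hc.2.2 G hG)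
          (Finset.ssubset_iff_subset_ne.2 ⟨h', fun e => haG (e ▸ ha)⟩)
      · exact absurd (h' ha) haG
    rw [Finset.mem_Icc]
    omega

/-- The elements of level less than `m` in a complete flag form a flat of rank `m`. -/
lemma IsRankFlag.levelSet (hc : IsRankFlag ρ c) (h : IsRankFunction ρ) (hl : ∀ a, 0 < ρ {a})
    {m : ℕ} (hm : m ≤ ρ Finset.univ) :
    IsRankFlat ρ (Finset.univ.filter fun a => coneLevel c a < m) ∧
      ρ (Finset.univ.filter fun a => coneLevel c a < m) = m := by
  rcases Nat.eq_zero_or_pos m with rfl | hm0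
  · simpa using ⟨isRankFlat_empty h.empty hl, h.empty⟩
  rcases hm.eq_or_lt with rfl | hm
  · have : (Finset.univ.filter fun a => coneLevel c a < ρ Finset.univ) = Finset.univ :=
      Finset.filter_true_of_mem fun a _ => by
        have := coneLevel_le c a
        have := hc.2.1
        omega
    rw [this]
    exact ⟨isRankFlat_univ ρ, rfl⟩
  · obtain ⟨F, hF, rfl⟩ := hc.exists_rank_eq h hl hm0 hm
    have : (Finset.univ.filter fun a => coneLevel c a < ρ F.1) = F.1 := by
      ext a
      simpa using hc.coneLevel_lt_iff h hl hF a
    rw [this]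
    exact ⟨hc.2.2 F hF, rfl⟩

lemma IsRankFlag.growth_le (hc : IsRankFlag ρ c) (σ : Equiv.Perm (Fin (n + 1))) (k : ℕ) :
    growth (coneLevel c ∘ σ) k ≤ ρ Finset.univ := by
  rw [growth, Finset.sup_le_iff]
  intro p _
  have := coneLevel_le c (σ p)
  have := hc.2.1
  simp only [Function.comp_apply]
  omega

lemma prefixSet_subset_levelSet (c : Finset (ProperSubset n)) (σ : Equiv.Perm (Fin (n + 1)))
    (k : ℕ) : prefixSet σ k
      ⊆ Finset.univ.filter fun a => coneLevel c a < growth (coneLevel c ∘ σ) k := by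
  intro a ha
  rw [growth_comp, Finset.mem_filter, ← Nat.succ_le_iff]
  exact ⟨Finset.mem_univ a, Finset.le_sup (f := fun a => coneLevel c a + 1) ha⟩

lemma IsRankFlag.rank_prefixSet_le (hc : IsRankFlag ρ c) (h : IsRankFunction ρ)
    (hl : ∀ a, 0 < ρ {a}) (σ : Equiv.Perm (Fin (n + 1))) (k : ℕ) :
    ρ (prefixSet σ k) ≤ growth (coneLevel c ∘ σ) k := by
  refine (h.mono (prefixSet_subset_levelSet c σ k)).trans_eq ?_
  exact (hc.levelSet h hl (hc.growth_le σ k)).2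

/-- If the levels of `σ 0, …, σ n` in a complete flag form a word of restricted growth, they
determine the ranks of the prefixes of `σ`. -/
lemma IsRankFlag.rank_prefixSet_eq (hc : IsRankFlag ρ c) (h : IsRankFunction ρ)
    (hl : ∀ a, 0 < ρ {a}) {σ : Equiv.Perm (Fin (n + 1))}
    (hσ : IsRestrictedGrowth (coneLevel c ∘ σ)) {k : ℕ} (hk : k ≤ n + 1) :
    ρ (prefixSet σ k) = growth (coneLevel c ∘ σ) k := by
  refine le_antisymm (hc.rank_prefixSet_le h hl σ k) ?_
  induction k with
  | zero => simp [growth_zero]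
  | succ k ih =>
    have ih := ih (by omega)
    let p : Fin (n + 1) := ⟨k, hk⟩
    have h1 : growth (coneLevel c ∘ σ) (k + 1) = _ := growth_succ (coneLevel c ∘ σ) p
    have h2 : prefixSet σ (k + 1) = _ := prefixSet_succ σ p
    have h3 := hσ p
    have h4 : ρ (prefixSet σ k) ≤ ρ (prefixSet σ (k + 1)) :=
      h.mono (prefixSet_mono σ (Nat.le_succ k))
    rw [h1]
    refine max_le ?_ (ih.trans h4)
    have h7 : growth (coneLevel c ∘ σ) p = growth (coneLevel c ∘ σ) k := rfl
    by_cases hlt : (coneLevel c ∘ σ) p < growth (coneLevel c ∘ σ) k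
    · omega
    -- A record: the new element lies outside the flat spanned by the preceding ones.
    · have hout : σ p ∉ Finset.univ.filter
          fun a => coneLevel c a < growth (coneLevel c ∘ σ) k := by
        simpa using hlt
      have h5 := hc.levelSet h hl (hc.growth_le σ k)
      have h6 := h.insert_add_le (prefixSet_subset_levelSet c σ k) (σ p)
      rw [h.insert_eq h5.1 hout, h5.2] at h6
      rw [h2]
      have h8 : ρ (prefixSet σ p) = ρ (prefixSet σ k) := rfl
      have h9 : ρ (insert (σ p) (prefixSet σ p)) = ρ (insert (σ p) (prefixSet σ k)) := rfl
      omega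

lemma IsRankFunction.exists_rank_prefixSet_eq (h : IsRankFunction ρ)
    (σ : Equiv.Perm (Fin (n + 1))) {m : ℕ} (hm : m ≤ ρ Finset.univ) :
    ∃ k ≤ n + 1, ρ (prefixSet σ k) = m := by
  have huniv : prefixSet σ (n + 1) = Finset.univ :=
    Finset.eq_univ_of_forall fun a => mem_prefixSet.2 (σ.symm a).isLt
  have hex : ∃ k, m ≤ ρ (prefixSet σ k) := ⟨n + 1, by rwa [huniv]⟩
  classical
  have hle : Nat.find hex ≤ n + 1 := Nat.find_min' hex (by rwa [huniv])
  refine ⟨Nat.find hex, hle, le_antisymm ?_ (Nat.find_spec hex)⟩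
  rcases hk : Nat.find hex with _ | k
  · have : prefixSet σ 0 = ∅ := by ext a; simp
    rw [this, h.empty]
    exact Nat.zero_le m
  · have h1 := Nat.find_min hex (m := k) (by omega)
    have h2 := h.insert_le (σ ⟨k, by omega⟩) (prefixSet σ k)
    have h3 : prefixSet σ (k + 1) = _ := prefixSet_succ σ ⟨k, by omega⟩
    rw [h3]
    exact h2.trans (by omega)

lemma IsRankFlag.subset_of_isRestrictedGrowth (hc : IsRankFlag ρ c) (hd : IsRankFlag ρ d)
    (h : IsRankFunction ρ) (hl : ∀ a, 0 < ρ {a}) {σ : Equiv.Perm (Fin (n + 1))}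
    (hcσ : IsRestrictedGrowth (coneLevel c ∘ σ)) (hdσ : IsRestrictedGrowth (coneLevel d ∘ σ)) :
    c ⊆ d := by
  intro F hF
  have hlt := h.lt_univ (hc.2.2 F hF)
  obtain ⟨G, hG, hFG⟩ := hd.exists_rank_eq h hl (h.pos_of_nonempty hl F.2.1) hlt
  obtain ⟨k, hk, hkF⟩ := h.exists_rank_prefixSet_eq σ hlt.le
  -- Both members of rank `ρ F` are the closure of the first prefix of that rank.
  have key : ∀ {e : Finset (ProperSubset n)} {A : ProperSubset n}, IsRankFlag ρ e →
      IsRestrictedGrowth (coneLevel e ∘ σ) → A ∈ e → ρ A.1 = ρ F.1 →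
      rankClosure ρ (prefixSet σ k) = A.1 := by
    intro e A he heσ hA hAF
    refine h.rankClosure_eq (he.2.2 A hA) (fun a ha => ?_) (by omega)
    have := prefixSet_subset_levelSet e σ k ha
    rw [← he.rank_prefixSet_eq h hl heσ hk, hkF, ← hAF] at this
    exact (he.coneLevel_lt_iff h hl hA a).1 (Finset.mem_filter.1 this).2
  rwa [Subtype.ext ((key hc hcσ hF rfl).symm.trans (key hd hdσ hG hFG))]

/-- Each permutation belongs to exactly one complete flag of flats, that of the closures of its
prefixes. -/
lemma IsRankFunction.existsUnique_flag (h : IsRankFunction ρ) (hl : ∀ a, 0 < ρ {a})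
    (σ : Equiv.Perm (Fin (n + 1))) :
    ∃! c, IsRankFlag ρ c ∧ IsRestrictedGrowth (coneLevel c ∘ σ) := by
  classical
  set c : Finset (ProperSubset n) :=
    Finset.univ.filter fun F => ∃ k, F.1 = rankClosure ρ (prefixSet σ k) with hcdef
  have hmem : ∀ F, F ∈ c ↔ ∃ k, F.1 = rankClosure ρ (prefixSet σ k) := fun F => by simp [hcdef]
  have hcone : IsCone c := by
    intro F hF G hG
    obtain ⟨k, hk⟩ := (hmem F).1 hF
    obtain ⟨l, hl⟩ := (hmem G).1 hG
    rw [hk, hl]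
    exact (le_total k l).imp (fun hkl => h.rankClosure_mono (prefixSet_mono σ hkl))
      fun hkl => h.rankClosure_mono (prefixSet_mono σ hkl)
  have hflat : ∀ F ∈ c, IsRankFlat ρ F.1 := by
    intro F hF
    obtain ⟨k, hk⟩ := (hmem F).1 hF
    rw [hk]
    exact h.isRankFlat_rankClosure _
  have hinj := hcone.rank_injOn h hflat
  have hpos : 0 < ρ Finset.univ := h.pos_of_nonempty hl Finset.univ_nonempty
  have himg : c.image (fun F => ρ F.1) = Finset.Icc 1 (ρ Finset.univ - 1) := by
    ext m
    rw [Finset.mem_image, Finset.mem_Icc]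
    constructor
    · rintro ⟨F, hF, rfl⟩
      have h1 := h.pos_of_nonempty hl F.2.1
      have h2 := h.lt_univ (hflat F hF)
      omega
    · intro hm
      obtain ⟨k, -, hk⟩ := h.exists_rank_prefixSet_eq σ (m := m) (by omega)
      have hrk := h.rank_rankClosure (prefixSet σ k)
      refine ⟨⟨rankClosure ρ (prefixSet σ k), ?_, fun e => ?_⟩, (hmem _).2 ⟨k, rfl⟩,
        hrk.trans hk⟩
      · rw [Finset.nonempty_iff_ne_empty]
        intro e
        rw [e, h.empty] at hrk
        omega
      · rw [e] at hrk
        omega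
  have hcard : c.card = ρ Finset.univ - 1 := by
    rw [← Finset.card_image_of_injOn hinj, himg, Nat.card_Icc]
    omega
  have hflag : IsRankFlag ρ c := ⟨hcone, by omega, hflat⟩
  have hσ : IsRestrictedGrowth (coneLevel c ∘ σ) := by
    intro p
    refine le_trans ?_ (hflag.rank_prefixSet_le h hl σ p)
    have himg' : (c.filter fun F => σ p ∉ F.1).image (fun F => ρ F.1)
        ⊆ Finset.Icc 1 (ρ (prefixSet σ p)) := by
      intro m hm
      obtain ⟨F, hF, rfl⟩ := Finset.mem_image.1 hm
      obtain ⟨hF, hpF⟩ := Finset.mem_filter.1 hF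
      obtain ⟨k, hk⟩ := (hmem F).1 hF
      rw [Finset.mem_Icc]
      refine ⟨h.pos_of_nonempty hl F.2.1, ?_⟩
      rw [hk, h.rank_rankClosure]
      refine h.mono (prefixSet_mono σ (not_lt.1 fun hlt => hpF ?_))
      rw [hk]
      exact IsRankFunction.subset_rankClosure _ (by simpa using hlt)
    have := Finset.card_le_card himg'
    rwa [Finset.card_image_of_injOn
      (hinj.mono (Finset.coe_subset.2 (Finset.filter_subset _ _))), Nat.card_Icc,
      Nat.add_sub_cancel] at this
  refine ⟨c, ⟨hflag, hσ⟩, fun d hd => ?_⟩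
  exact (hd.1.subset_of_isRestrictedGrowth hflag h hl hd.2 hσ).antisymm
    (hflag.subset_of_isRestrictedGrowth hd.1 h hl hσ hd.2)

end Flags

/-! ### The `𝒢`-invariant in terms of complete flags -/

open Classical in
/-- The sum of the record sequences of the rearrangements of restricted growth of a word. -/
def recordSum (w : Fin (n + 1) → ℕ) : (Fin (n + 1) → ℕ) →₀ ℤ :=
  ∑ σ : Equiv.Perm (Fin (n + 1)),
    if IsRestrictedGrowth (w ∘ σ) then Finsupp.single (recordSeq (w ∘ σ)) 1 else 0

lemma recordSum_comp (w : Fin (n + 1) → ℕ) (π : Equiv.Perm (Fin (n + 1))) :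
    recordSum (w ∘ π) = recordSum w := by
  classical
  exact Fintype.sum_equiv (Equiv.mulLeft π) _ _ fun σ => rfl

/-- The increasing word of the levels in a flag whose members have the cardinalities in `K`. -/
def sizeWord (n : ℕ) (K : Finset ℕ) (p : Fin (n + 1)) : ℕ :=
  (K.filter fun k => k ≤ (p : ℕ)).card

lemma IsCone.recordSum_coneLevel {c : Finset (ProperSubset n)} (hc : IsCone c) :
    recordSum (coneLevel c) = recordSum (sizeWord n (coneSizes c)) := by
  obtain ⟨σ, hσ⟩ := hc.exists_perm
  rw [← recordSum_comp (coneLevel c) σ]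
  congr 1
  funext p
  rw [sizeWord, coneSizes, Finset.filter_image, Finset.card_image_of_injOn
    (hc.card_injOn.mono (Finset.coe_subset.2 (Finset.filter_subset _ _)))]
  rw [Function.comp_apply, coneLevel]
  congr 1
  refine Finset.filter_congr fun F hF => ?_
  conv_lhs => rw [hσ F hF, mem_prefixSet, Equiv.symm_apply_apply, not_lt]

open Classical in
/-- The number of complete flags of flats whose members have the cardinalities in `K`. -/
def flagCount (ρ : Finset (Fin (n + 1)) → ℕ) (K : Finset ℕ) : ℕ :=
  (Finset.univ.filter fun c : Finset (ProperSubset n) => IsRankFlag ρ c ∧ coneSizes c = K).card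

lemma sum_single_eq_sum_flagCount {ρ : Finset (Fin (n + 1)) → ℕ} (h : IsRankFunction ρ)
    (hl : ∀ a, 0 < ρ {a}) {r : ℕ} (hr : ρ Finset.univ = r + 1) :
    ∑ σ : Equiv.Perm (Fin (n + 1)), Finsupp.single
      (fun j : Fin (n + 1) => ρ (prefixSet σ ((j : ℕ) + 1)) - ρ (prefixSet σ j)) (1 : ℤ)
    = ∑ K ∈ (Finset.Icc 1 n).powersetCard r, (flagCount ρ K : ℤ) • recordSum (sizeWord n K) := by
  classical
  calc _ = ∑ σ : Equiv.Perm (Fin (n + 1)), ∑ c ∈ Finset.univ.filter (IsRankFlag ρ),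
        if IsRestrictedGrowth (coneLevel c ∘ σ) then
          Finsupp.single (recordSeq (coneLevel c ∘ σ)) (1 : ℤ) else 0 := by
        refine Finset.sum_congr rfl fun σ _ => ?_
        obtain ⟨c, ⟨hc, hσ⟩, hu⟩ := h.existsUnique_flag hl σ
        rw [Finset.sum_eq_single_of_mem c (by simpa using hc), if_pos hσ]
        · congr 1
          funext j
          rw [recordSeq, hc.rank_prefixSet_eq h hl hσ (by omega),
            hc.rank_prefixSet_eq h hl hσ (by omega)]
        · intro d hd hdc
          exact if_neg fun hdσ => hdc (hu d ⟨(Finset.mem_filter.1 hd).2, hdσ⟩)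
    _ = ∑ c ∈ Finset.univ.filter (IsRankFlag ρ), recordSum (sizeWord n (coneSizes c)) := by
        rw [Finset.sum_comm]
        refine Finset.sum_congr rfl fun c hc => ?_
        rw [← (Finset.mem_filter.1 hc).2.1.recordSum_coneLevel, recordSum]
    _ = _ := by
        rw [← Finset.sum_fiberwise_of_maps_to (g := coneSizes)
          (t := (Finset.Icc 1 n).powersetCard r)]
        · refine Finset.sum_congr rfl fun K _ => ?_
          rw [Finset.sum_congr rfl fun c hc => by rw [(Finset.mem_filter.1 hc).2],
            Finset.sum_const, flagCount, Finset.filter_filter, natCast_zsmul]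
        · intro c hc
          have hc := (Finset.mem_filter.1 hc).2
          rw [Finset.mem_powersetCard]
          exact ⟨coneSizes_subset c, by have := hc.1.card_coneSizes; have := hc.2.1; omega⟩

lemma sizeWord_mono (K : Finset ℕ) : Monotone (sizeWord n K) := fun _ _ hpq =>
  Finset.card_le_card (Finset.monotone_filter_right K fun _ _ hk => hk.trans hpq)

lemma growth_sizeWord (K : Finset ℕ) (p : Fin (n + 1)) :
    growth (sizeWord n K) ((p : ℕ) + 1) = sizeWord n K p + 1 := by
  refine le_antisymm (Finset.sup_le fun q hq => ?_) ?_
  · have : (q : ℕ) < p + 1 := (Finset.mem_filter.1 hq).2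
    exact Nat.succ_le_succ (sizeWord_mono K (Fin.le_def.2 (by omega)))
  · exact Finset.le_sup (f := fun q => sizeWord n K q + 1) (by simp)

lemma isRestrictedGrowth_sizeWord {K : Finset ℕ} (hK : K ⊆ Finset.Icc 1 n) :
    IsRestrictedGrowth (sizeWord n K) := by
  rintro ⟨p, hp⟩
  rcases p with _ | p
  · rw [sizeWord, Finset.filter_false_of_mem]
    · simp
    · intro k hk
      have := Finset.mem_Icc.1 (hK hk)
      simp only
      omega
  · have := growth_sizeWord (n := n) K ⟨p, by omega⟩
    simp only at this ⊢
    rw [this, sizeWord, sizeWord]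
    have hsub : (K.filter fun k => k ≤ p + 1) ⊆ insert (p + 1) (K.filter fun k => k ≤ p) := by
      intro k hk
      simp only [Finset.mem_filter, Finset.mem_insert] at hk ⊢
      rcases Nat.lt_or_ge p k with h | h
      · exact Or.inl (by omega)
      · exact Or.inr ⟨hk.1, h⟩
    exact (Finset.card_le_card hsub).trans (Finset.card_insert_le _ _)

lemma growth_eq_of_recordSeq_eq {v w : Fin (n + 1) → ℕ} (h : recordSeq v = recordSeq w) {k : ℕ}
    (hk : k ≤ n + 1) : growth v k = growth w k := by
  induction k with
  | zero => rw [growth_zero, growth_zero]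
  | succ k ih =>
    have ih := ih (by omega)
    have h1 := congrFun h ⟨k, hk⟩
    have h2 : growth v k ≤ growth v (k + 1) := (le_max_right _ _).trans_eq
      (growth_succ v ⟨k, hk⟩).symm
    have h3 : growth w k ≤ growth w (k + 1) := (le_max_right _ _).trans_eq
      (growth_succ w ⟨k, hk⟩).symm
    simp only [recordSeq] at h1
    omega

/-- Among the first letters of a rearrangement of an increasing word there is always one that is
at least as large as in the word itself. -/
lemma le_growth_comp {w : Fin (n + 1) → ℕ} (hw : Monotone w) (σ : Equiv.Perm (Fin (n + 1)))
    (p : Fin (n + 1)) : w p + 1 ≤ growth (w ∘ σ) ((p : ℕ) + 1) := by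
  have hex : ∃ a ∈ prefixSet σ ((p : ℕ) + 1), p ≤ a := by
    by_contra! hlt
    have h1 : prefixSet σ ((p : ℕ) + 1) ⊆ Finset.Iio p := fun a ha => Finset.mem_Iio.2 (hlt a ha)
    have h2 := Finset.card_le_card h1
    rw [card_prefixSet σ (by omega), Fin.card_Iio] at h2
    omega
  obtain ⟨a, ha, hpa⟩ := hex
  rw [growth_comp]
  exact (Nat.succ_le_succ (hw hpa)).trans (Finset.le_sup (f := fun a => w a + 1) ha)

lemma recordSum_apply (w : Fin (n + 1) → ℕ) (s : Fin (n + 1) → ℕ) :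
    recordSum w s = (Nat.card {σ : Equiv.Perm (Fin (n + 1)) //
      IsRestrictedGrowth (w ∘ σ) ∧ recordSeq (w ∘ σ) = s} : ℤ) := by
  classical
  rw [Nat.card_eq_fintype_card, Fintype.card_subtype, recordSum, Finset.card_filter,
    Finsupp.finsetSum_apply]
  push_cast
  refine Finset.sum_congr rfl fun σ _ => ?_
  by_cases h1 : IsRestrictedGrowth (w ∘ σ) <;> simp [h1, Finsupp.single_apply]

/-- Triangularity: the record sequence of the word of `K` occurs in the record sum of the word
of `J` only if the word of `J` is bounded by that of `K`. -/
lemma sizeWord_le_of_recordSum_ne_zero {J K : Finset ℕ}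
    (h : recordSum (sizeWord n J) (recordSeq (sizeWord n K)) ≠ 0) :
    sizeWord n J ≤ sizeWord n K := by
  rw [recordSum_apply, Nat.cast_ne_zero, Nat.card_ne_zero] at h
  obtain ⟨⟨σ, -, hσ⟩⟩ := h.1
  intro p
  have h1 := le_growth_comp (sizeWord_mono J) σ p
  rw [growth_eq_of_recordSeq_eq hσ (by omega), growth_sizeWord] at h1
  exact Nat.le_of_succ_le_succ h1

lemma recordSum_self_ne_zero {K : Finset ℕ} (hK : K ⊆ Finset.Icc 1 n) :
    recordSum (sizeWord n K) (recordSeq (sizeWord n K)) ≠ 0 := by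
  rw [recordSum_apply, Nat.cast_ne_zero, Nat.card_ne_zero]
  exact ⟨⟨⟨1, isRestrictedGrowth_sizeWord hK, rfl⟩⟩, inferInstance⟩

lemma sizeWord_injOn : Set.InjOn (sizeWord n) {K | K ⊆ Finset.Icc 1 n} := by
  have hsucc : ∀ (K : Finset ℕ) (p : ℕ), (K.filter fun k => k ≤ p + 1).card
      = (K.filter fun k => k ≤ p).card + if p + 1 ∈ K then 1 else 0 := by
    intro K p
    have : (K.filter fun k => k ≤ p + 1)
        = (K.filter fun k => k ≤ p) ∪ K.filter fun k => k = p + 1 := by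
      rw [← Finset.filter_or]
      exact Finset.filter_congr fun k _ => by omega
    rw [this, Finset.card_union_of_disjoint, Finset.filter_eq' K (p + 1)]
    · split_ifs <;> simp
    · exact Finset.disjoint_filter.2 fun k _ h1 h2 => by omega
  intro J hJ K hK hJK
  ext k
  by_cases hk : k ∈ Finset.Icc 1 n
  · rw [Finset.mem_Icc] at hk
    obtain ⟨p, rfl⟩ : ∃ p, k = p + 1 := ⟨k - 1, by omega⟩
    have h1 := congrFun hJK ⟨p, by omega⟩
    have h2 := congrFun hJK ⟨p + 1, by omega⟩
    simp only [sizeWord] at h1 h2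
    rw [hsucc, hsucc, h1] at h2
    by_cases h3 : p + 1 ∈ J <;> by_cases h4 : p + 1 ∈ K <;> simp [h3, h4] at h2 ⊢
  · exact iff_of_false (fun h => hk (hJ h)) fun h => hk (hK h)

/-- The record sums of the increasing words are linearly independent. -/
lemma recordSum_independent {r : ℕ} {f g : Finset ℕ → ℕ}
    (h : ∑ K ∈ (Finset.Icc 1 n).powersetCard r, (f K : ℤ) • recordSum (sizeWord n K)
      = ∑ K ∈ (Finset.Icc 1 n).powersetCard r, (g K : ℤ) • recordSum (sizeWord n K))
    {K : Finset ℕ} (hK : K ∈ (Finset.Icc 1 n).powersetCard r) : f K = g K := by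
  induction hN : ∑ p, sizeWord n K p using Nat.strong_induction_on generalizing K with
  | _ N ih =>
  have h1 := DFunLike.congr_fun h (recordSeq (sizeWord n K))
  rw [← sub_eq_zero, Finsupp.finsetSum_apply, Finsupp.finsetSum_apply,
    ← Finset.sum_sub_distrib, Finset.sum_eq_single_of_mem K hK] at h1
  · rw [Finsupp.smul_apply, Finsupp.smul_apply, ← sub_smul, smul_eq_mul, mul_eq_zero] at h1
    rcases h1 with h1 | h1
    · omega
    · exact absurd h1 (recordSum_self_ne_zero (Finset.mem_powersetCard.1 hK).1)
  · intro J hJ hJK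
    rw [Finsupp.smul_apply, Finsupp.smul_apply, ← sub_smul, smul_eq_mul, mul_eq_zero]
    by_cases h0 : recordSum (sizeWord n J) (recordSeq (sizeWord n K)) = 0
    · exact Or.inr h0
    · have hle := sizeWord_le_of_recordSum_ne_zero h0
      have hne : sizeWord n J ≠ sizeWord n K := fun e => hJK (sizeWord_injOn
        (Finset.mem_powersetCard.1 hJ).1 (Finset.mem_powersetCard.1 hK).1 e)
      obtain ⟨p, hp⟩ := Pi.lt_def.1 (lt_of_le_of_ne hle hne) |>.2
      have := Finset.sum_lt_sum (fun q _ => hle q) ⟨p, Finset.mem_univ p, hp⟩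
      rw [ih _ (hN ▸ this) hJ rfl, sub_self]
      exact Or.inl rfl

/-! ### Matroids -/

section Matroid

variable {M : Matroid (Fin (n + 1))}

/-- The rank function of a matroid, on finite sets and with values in `ℕ`. -/
def matroidRank (M : Matroid (Fin (n + 1))) (S : Finset (Fin (n + 1))) : ℕ :=
  (M.eRk (S : Set (Fin (n + 1)))).toNat

lemma coe_matroidRank (M : Matroid (Fin (n + 1))) (S : Finset (Fin (n + 1))) :
    (matroidRank M S : ℕ∞) = M.eRk (S : Set (Fin (n + 1))) :=
  ENat.natCast_toNat (Matroid.eRk_ne_top_iff.2 (M.isRkFinite_of_finite S.finite_toSet))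

lemma isRankFunction_matroidRank (M : Matroid (Fin (n + 1))) :
    IsRankFunction (matroidRank M) where
  empty := by simp [matroidRank]
  mono {S T} hST := by
    rw [← Nat.cast_le (α := ℕ∞), coe_matroidRank, coe_matroidRank]
    exact M.eRk_mono (Finset.coe_subset.2 hST)
  insert_le a S := by
    rw [← Nat.cast_le (α := ℕ∞), Nat.cast_add, Nat.cast_one, coe_matroidRank, coe_matroidRank,
      Finset.coe_insert]
    exact M.eRk_insert_le_add_one a S
  submodular S T := by
    rw [← Nat.cast_le (α := ℕ∞), Nat.cast_add, Nat.cast_add, coe_matroidRank, coe_matroidRank,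
      coe_matroidRank, coe_matroidRank, Finset.coe_union, Finset.coe_inter, add_comm]
    exact M.eRk_inter_add_eRk_union_le S T

lemma matroidRank_univ (hE : M.E = Set.univ) :
    (matroidRank M Finset.univ : ℕ∞) = M.eRank := by
  rw [coe_matroidRank, Finset.coe_univ, ← hE, Matroid.eRk_ground]

lemma matroidRank_singleton_pos (hE : M.E = Set.univ) (hl : M.Loopless) (a : Fin (n + 1)) :
    0 < matroidRank M {a} := by
  rw [← Nat.cast_pos (α := ℕ∞), coe_matroidRank, Finset.coe_singleton,
    Matroid.eRk_singleton_eq (hE ▸ Set.mem_univ a)]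
  exact one_pos

lemma isRankFlat_matroidRank_iff (hE : M.E = Set.univ) (S : Finset (Fin (n + 1))) :
    IsRankFlat (matroidRank M) S ↔ M.IsFlat (S : Set (Fin (n + 1))) := by
  have hS : (S : Set (Fin (n + 1))) ⊆ M.E := hE ▸ Set.subset_univ _
  rw [Matroid.isFlat_iff_closure_eq]
  constructor
  · intro h
    refine (Set.Subset.antisymm (M.subset_closure S) fun a ha => ?_).symm
    by_contra haS
    have h1 := h a (by simpa using haS)
    rw [← Nat.cast_lt (α := ℕ∞), coe_matroidRank, coe_matroidRank, Finset.coe_insert,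
      ← M.eRk_closure_eq S] at h1
    exact absurd (M.eRk_mono (Set.insert_subset ha (M.subset_closure S))) (not_le.2 h1)
  · intro h a ha
    have h1 : M.eRk (insert a (S : Set (Fin (n + 1)))) = M.eRk S + 1 :=
      Matroid.eRk_insert_eq_add_one ⟨hE ▸ Set.mem_univ a, by rw [h]; simpa using ha⟩
    rw [← Finset.coe_insert, ← coe_matroidRank, ← coe_matroidRank] at h1
    have h2 : matroidRank M (insert a S) = matroidRank M S + 1 := by exact_mod_cast h1
    omega

lemma isRankFlag_matroidRank_iff (hE : M.E = Set.univ) {c : Finset (ProperSubset n)}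
    (hc : IsCone c) : IsRankFlag (matroidRank M) c ↔
      (c.card : ℕ∞) + 1 = M.eRank ∧ ∀ F ∈ c, M.IsFlat (F.1 : Set (Fin (n + 1))) := by
  rw [IsRankFlag, and_iff_right hc, ← matroidRank_univ hE]
  simp only [isRankFlat_matroidRank_iff hE]
  norm_cast

theorem exists_isMatroidClass (hE : M.E = Set.univ) (hl : M.Loopless) :
    ∃ ξ : Chow n, IsMatroidClass M ξ := by
  classical
  obtain ⟨ξ, hξ⟩ := exists_forall_degreeMap_eq (isRankFunction_matroidRank M)
    (matroidRank_singleton_pos hE hl)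
  exact ⟨ξ, fun c hc => (hξ c hc).trans
    (if_congr (isRankFlag_matroidRank_iff hE hc) rfl rfl)⟩

lemma isMatroidClass_matroidClass (hE : M.E = Set.univ) (hl : M.Loopless) :
    IsMatroidClass M (matroidClass M) := by
  rw [matroidClass, dif_pos (exists_isMatroidClass hE hl)]
  exact (exists_isMatroidClass hE hl).choose_spec

lemma degreeMap_matroidClass_mul_prod_sizeClass (hE : M.E = Set.univ) (hl : M.Loopless)
    (K : Finset ℕ) :
    degreeMap n (matroidClass M * ∏ k ∈ K, sizeClass n k) = flagCount (matroidRank M) K := by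
  classical
  rw [prod_sizeClass_eq, Finset.mul_sum, map_sum, flagCount, Finset.card_filter,
    Finset.sum_filter]
  push_cast
  refine Finset.sum_congr rfl fun c _ => ?_
  by_cases hc : IsCone c
  · rw [isMatroidClass_matroidClass hE hl c hc,
      if_congr (isRankFlag_matroidRank_iff hE hc).symm rfl rfl]
    by_cases hK : coneSizes c = K <;> simp [hc, hK]
  · rw [if_neg fun h => hc h.1, if_neg fun h => hc h.1.1]

lemma prefixRank_eq (M : Matroid (Fin (n + 1))) (σ : Equiv.Perm (Fin (n + 1))) (k : ℕ) :
    prefixRank M σ k = matroidRank M (prefixSet σ k) := by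
  rw [prefixRank, matroidRank, prefixSet_eq_map]
  congr 2
  ext a
  simp

lemma gInvariant_eq (hE : M.E = Set.univ) (hl : M.Loopless) {r : ℕ}
    (hr : M.eRank = (r : ℕ∞) + 1) : gInvariant M
      = ∑ K ∈ (Finset.Icc 1 n).powersetCard r,
        (flagCount (matroidRank M) K : ℤ) • recordSum (sizeWord n K) := by
  have hr' : matroidRank M Finset.univ = r + 1 := by
    rw [← matroidRank_univ hE] at hr
    exact_mod_cast hr
  rw [← sum_single_eq_sum_flagCount (isRankFunction_matroidRank M)
    (matroidRank_singleton_pos hE hl) hr']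
  refine Finset.sum_congr rfl fun σ _ => congrArg (Finsupp.single · 1) (funext fun j => ?_)
  rw [rankSequence, prefixRank_eq, prefixRank_eq]

end Matroid

end Permutohedral

end

open Permutohedral in
theorem theorem1 (n r : ℕ) (M₁ M₂ : Matroid (Fin (n + 1)))
    (hE₁ : M₁.E = Set.univ) (hE₂ : M₂.E = Set.univ)
    (hl₁ : M₁.Loopless) (hl₂ : M₂.Loopless)
    (hr₁ : M₁.eRank = (r : ℕ∞) + 1) (hr₂ : M₂.eRank = (r : ℕ∞) + 1) :
    Permutohedral.gInvariant M₁ = Permutohedral.gInvariant M₂ ↔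
      ∀ a : Fin n → ℕ, ∑ i, a i = r →
        Permutohedral.mixedEulerian M₁ a = Permutohedral.mixedEulerian M₂ a := by
  have hprod : ∀ a : Fin n → ℕ, ∏ i : Fin n, hypersimplexDivisor n ((i : ℕ) + 1) ^ a i
      = ∏ i : Fin n, hypersimplexClass n (n - i) ^ a i := fun a =>
    Finset.prod_congr rfl fun i _ => by
      rw [hypersimplexDivisor_eq (by omega), Nat.add_sub_add_right]
  have hA := isHypersimplexPair.forall_monomial_iff (n := n)
    (degreeMap n ∘ₗ LinearMap.mulLeft ℚ (matroidClass M₁))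
    (degreeMap n ∘ₗ LinearMap.mulLeft ℚ (matroidClass M₂)) r
  simp only [LinearMap.comp_apply, LinearMap.mulLeft_apply,
    degreeMap_matroidClass_mul_prod_sizeClass hE₁ hl₁,
    degreeMap_matroidClass_mul_prod_sizeClass hE₂ hl₂, Nat.cast_inj] at hA
  simp only [mixedEulerian, hprod]
  rw [hA, gInvariant_eq hE₁ hl₁ hr₁, gInvariant_eq hE₂ hl₂ hr₂]
  constructor
  · exact fun h K hK hr => recordSum_independent h (Finset.mem_powersetCard.2 ⟨hK, hr⟩)
  · intro h
    refine Finset.sum_congr rfl fun K hK => ?_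
    rw [Finset.mem_powersetCard] at hK
    rw [h K hK.1 hK.2]
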